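/- **Setting.** Let $f:\mathbb R^n\to\mathbb R$ be differentiable, $L$-smooth ($L>0$, $\|\nabla f(x)-\nabla f(y)\|_2\le L\|x-y\|_2$ for all $x,y$) and $\mu$-strongly convex ($\mu>0$, $f(x)\ge f(y)+\langle\nabla f(y),x-y\rangle+\frac\mu2\|x-y\|_2^2$ for all $x,y$), and let $x^*$ be a minimizer of $f$. Stochastic gradients $\nabla f(x,\xi)$ (jointly measurable in $(x,\xi)$) satisfy, for every $x\in\mathbb R^n$, $\mathbb E_\xi[\nabla f(x,\xi)]=\nabla f(x)$ and $\mathbb E_\xi\|\nabla f(x,\xi)-\nabla f(x)\|_2^2\le\sigma^2$, where $\sigma\ge0$; no light-tail assumption is made. Let $\mathrm{clip}(v,\lambda)=\min\{1,\lambda/\|v\|_2\}\,v$. **Algorithms.** *clipped-SSTM* with starting point $x^0$, $N$ iterations, batch sizes $m_k$, stepsize parameter $a$ and clipping parameter $B$: set $A_0=\alpha_0=0$, $y^0=z^0=x^0$; for $k=0,\dots,N-1$ put $\alpha_{k+1}=\frac{k+2}{2aL}$, $A_{k+1}=A_k+\alpha_{k+1}$, $\lambda_{k+1}=B/\alpha_{k+1}$,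 $x^{k+1}=(A_ky^k+\alpha_{k+1}z^k)/A_{k+1}$, draw fresh i.i.d. samples $\xi^k_1,\dots,\xi^k_{m_k}$, and set $z^{k+1}=z^k-\alpha_{k+1}\,\mathrm{clip}\big(\frac1{m_k}\sum_{i=1}^{m_k}\nabla f(x^{k+1},\xi^k_i),\lambda_{k+1}\big)$, $y^{k+1}=(A_ky^k+\alpha_{k+1}z^{k+1})/A_{k+1}$. The output is $y^N$. *R-clipped-SSTM*: $\hat x^0=x^0$, and for $t=0,\dots,\tau-1$ the point $\hat x^{t+1}$ is the output of $N_0$ iterations of clipped-SSTM started at $\hat x^t$ with batch sizes $\{m^t_k\}_k$, stepsize parameter $a$ and clipping parameter $B_t$. **Parameters.** Let $C=\sqrt5$ and $R=\sqrt{2(f(x^0)-f(x^*))/\mu}$. For $\beta\in(0,1)$ and integers $\tau$ and $N_0\ge1$ write $\ell=\ln\frac{4N_0\tau}{\beta}$, and let $$m_k^t=\left\lceil\max\Big\{1,\frac{6000\cdot2^t\sigma^2\alpha_{k+1}^2N_0\,\ell}{C^2R^2},\frac{10368\cdot2^t\sigma^2\alpha_{k+1}^2N_0}{C^2R^2}\Big\}\right\rceil,\qquad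 B_t=\frac{CR}{8\cdot2^{t/2}\,\ell},$$ $$a_{\min}=\max\Big\{1,\frac{16\,\ell}{C},36\big(2\ell+\sqrt{4\ell^2+2\ell}\big)^2\Big\}$$ (if $R=0$, read $m_k^t=1$). **Theorem.** 1. If $\ell\ge2$, $a\ge a_{\min}$ and $N_0\ge C\sqrt{8aL/\mu}$, then after $\tau$ runs of clipped-SSTM in R-clipped-SSTM $$f(\hat x^\tau)-f(x^*)\le2^{-\tau}\big(f(x^0)-f(x^*)\big)$$ holds with probability at least $1-\beta$. 2. Let $C_1\ge C$ and $q>1$. There is a constant $K>0$ depending only on $C_1$ and $q$ such that the following holds. Let $\varepsilon>0$ and $\tau=\max\{0,\lceil\log_2\frac{\mu R^2}{2\varepsilon}\rceil\}$ (with $\tau=0$ if $R=0$), and suppose that $\ell\ge2$ (so in particular $\tau\geq 1$), $a=a_{\min}$ and $C\sqrt{8aL/\mu}\le N_0\le C_1\sqrt{8aL/\mu}$. Then $f(\hat x^\tau)-f(x^*)\le\varepsilon$ with probability at least $1-\beta$. Moreover, whenever $\frac{L}{\mu\beta}\ln\frac{\mu R^2}{\varepsilon}\ge q$, the total number of iterations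 satisfies $$N_0\tau\le K\sqrt{\frac L\mu}\,\ln\Big(\frac{\mu R^2}{\varepsilon}\Big)\ln\Big(\frac{L}{\mu\beta}\ln\frac{\mu R^2}{\varepsilon}\Big)$$ and the total number of oracle calls satisfies $$\sum_{t=0}^{\tau-1}\sum_{k=0}^{N_0-1}m_k^t\le K\max\Big\{\sqrt{\frac L\mu}\,\ln\frac{\mu R^2}{\varepsilon},\ \frac{\sigma^2}{\mu\varepsilon}\Big\}\ln\Big(\frac{L}{\mu\beta}\ln\frac{\mu R^2}{\varepsilon}\Big).$$ 3. There is a numerical constant $C_1\ge C$ such that for all $0<\mu\le L$, $\beta\in(0,1)$ and $\tau\ge1$ there is an integer $N_0\ge1$ with $\ell\ge2$ and $C\sqrt{8a_{\min}L/\mu}\le N_0\le C_1\sqrt{8a_{\min}L/\mu}$; that is, the choice of parameters required in part 2 is always possible. -/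

import Mathlib

open MeasureTheory ProbabilityTheory Finset
open scoped Gradient

namespace ClippedSSTM

noncomputable section

/-- `f` is `L`-smooth: differentiable with an `L`-Lipschitz gradient. -/
def IsSmooth {n : ℕ} (L : ℝ) (f : EuclideanSpace ℝ (Fin n) → ℝ) : Prop :=
  Differentiable ℝ f ∧ ∀ x y, ‖∇ f x - ∇ f y‖ ≤ L * ‖x - y‖

/-- A differentiable `f` is `μ`-strongly convex. -/
def IsStronglyConvex {n : ℕ} (μ : ℝ) (f : EuclideanSpace ℝ (Fin n) → ℝ) : Prop :=
  Differentiable ℝ f ∧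
    ∀ x y, f x ≥ f y + inner ℝ (∇ f y) (x - y) + μ / 2 * ‖x - y‖ ^ 2

/-- `g x s` is the stochastic gradient at `x` computed from the sample `s`; for `s` distributed
according to `P` it is an unbiased estimator of `∇ f x` with variance at most `σ ^ 2`. -/
structure IsStochasticGradient {n : ℕ} {S : Type*} [MeasurableSpace S] (P : Measure S) (σ : ℝ)
    (f : EuclideanSpace ℝ (Fin n) → ℝ)
    (g : EuclideanSpace ℝ (Fin n) → S → EuclideanSpace ℝ (Fin n)) : Prop where
  measurable : Measurable (Function.uncurry g)
  integrable : ∀ x, Integrable (g x) P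
  unbiased : ∀ x, ∫ s, g x s ∂P = ∇ f x
  integrable_sq : ∀ x, Integrable (fun s => ‖g x s - ∇ f x‖ ^ 2) P
  variance_le : ∀ x, ∫ s, ‖g x s - ∇ f x‖ ^ 2 ∂P ≤ σ ^ 2

/-- The samples `ξ t k i` (run `t`, iteration `k`, position `i` in the batch) are independent and
all have law `P`. -/
structure IsIIDSample {Ω S : Type*} [MeasurableSpace Ω] [MeasurableSpace S] (Pr : Measure Ω)
    (P : Measure S) (ξ : ℕ → ℕ → ℕ → Ω → S) : Prop where
  measurable : ∀ t k i, Measurable (ξ t k i)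
  law : ∀ t k i, Measure.map (ξ t k i) Pr = P
  indep : iIndepFun (fun (p : ℕ × ℕ × ℕ) => ξ p.1 p.2.1 p.2.2) Pr

/-- `clip(v, lam) = min {1, lam / ‖v‖} v`, which is `0` for `v = 0`. -/
def clip {n : ℕ} (v : EuclideanSpace ℝ (Fin n)) (lam : ℝ) : EuclideanSpace ℝ (Fin n) :=
  min 1 (lam / ‖v‖) • v

/-- The stepsizes: `alpha 0 = 0` and `alpha (k + 1) = (k + 2) / (2 a L)`. -/
def alpha (a L : ℝ) : ℕ → ℝ
  | 0 => 0
  | k + 1 => ((k : ℝ) + 2) / (2 * a * L)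

/-- `bigA k = alpha 0 + ... + alpha k`. -/
def bigA (a L : ℝ) : ℕ → ℝ
  | 0 => 0
  | k + 1 => bigA a L k + alpha a L (k + 1)

/-- The mini-batch stochastic gradient at `x`, from the samples `s 0, ..., s (m - 1)`. -/
def miniBatch {n : ℕ} {S : Type*} (g : EuclideanSpace ℝ (Fin n) → S → EuclideanSpace ℝ (Fin n))
    (m : ℕ) (s : ℕ → S) (x : EuclideanSpace ℝ (Fin n)) : EuclideanSpace ℝ (Fin n) :=
  (m : ℝ)⁻¹ • ∑ i ∈ range m, g x (s i)

/-- clipped-SSTM with stepsize parameter `a`, clipping parameter `B` and batch sizes `m k`, started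
at `x₀`: the pair `(y, z)` after the given number of iterations. Iteration `k` uses the samples
`s k 0, ..., s k (m k - 1)`. -/
def sstm {n : ℕ} {S : Type*} (g : EuclideanSpace ℝ (Fin n) → S → EuclideanSpace ℝ (Fin n))
    (L a B : ℝ) (m : ℕ → ℕ) (s : ℕ → ℕ → S) (x₀ : EuclideanSpace ℝ (Fin n)) :
    ℕ → EuclideanSpace ℝ (Fin n) × EuclideanSpace ℝ (Fin n)
  | 0 => (x₀, x₀)
  | k + 1 =>
    let y := (sstm g L a B m s x₀ k).1
    let z := (sstm g L a B m s x₀ k).2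
    let x := (bigA a L (k + 1))⁻¹ • (bigA a L k • y + alpha a L (k + 1) • z)
    let z' := z - alpha a L (k + 1) • clip (miniBatch g (m k) (s k) x) (B / alpha a L (k + 1))
    let y' := (bigA a L (k + 1))⁻¹ • (bigA a L k • y + alpha a L (k + 1) • z')
    (y', z')

/-- R-clipped-SSTM: the point obtained from `x₀` after the given number of runs of clipped-SSTM,
each with `N₀` iterations and started at the output of the preceding one; run `t` uses the
clipping parameter `B t`, the batch sizes `m t k` and the samples `s t k i`. -/
def restartedSSTM {n : ℕ} {S : Type*}
    (g : EuclideanSpace ℝ (Fin n) → S → EuclideanSpace ℝ (Fin n)) (L a : ℝ) (N₀ : ℕ)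
    (B : ℕ → ℝ) (m : ℕ → ℕ → ℕ) (s : ℕ → ℕ → ℕ → S) (x₀ : EuclideanSpace ℝ (Fin n)) :
    ℕ → EuclideanSpace ℝ (Fin n)
  | 0 => x₀
  | t + 1 => (sstm g L a (B t) (m t) (s t) (restartedSSTM g L a N₀ B m s x₀ t) N₀).1

/-- The number of stochastic gradients evaluated by `τ` runs of `N₀` iterations. -/
def oracleCalls (N₀ τ : ℕ) (m : ℕ → ℕ → ℕ) : ℕ :=
  ∑ t ∈ range τ, ∑ k ∈ range N₀, m t k

/-- `R = √(2 (f x₀ - f x⋆) / μ)`. -/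
def radius {n : ℕ} (μ : ℝ) (f : EuclideanSpace ℝ (Fin n) → ℝ)
    (x₀ xs : EuclideanSpace ℝ (Fin n)) : ℝ :=
  √(2 * (f x₀ - f xs) / μ)

/-- `ln (4 N₀ τ / β)`. -/
def logTerm (N₀ τ : ℕ) (β : ℝ) : ℝ :=
  Real.log (4 * N₀ * τ / β)

/-- The least admissible stepsize parameter, with `C = √5`. -/
def aMin (N₀ τ : ℕ) (β : ℝ) : ℝ :=
  max 1 (max (16 * logTerm N₀ τ β / √5)
    (36 * (2 * logTerm N₀ τ β + √(4 * logTerm N₀ τ β ^ 2 + 2 * logTerm N₀ τ β)) ^ 2))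

/-- The batch size of iteration `k` in run `t`, with `C = √5`, rounded up to an integer. -/
def batchSize (L a σ R β : ℝ) (N₀ τ : ℕ) (t k : ℕ) : ℕ :=
  ⌈max 1 (max
    (6000 * 2 ^ t * σ ^ 2 * alpha a L (k + 1) ^ 2 * N₀ * logTerm N₀ τ β / (√5 ^ 2 * R ^ 2))
    (10368 * 2 ^ t * σ ^ 2 * alpha a L (k + 1) ^ 2 * N₀ / (√5 ^ 2 * R ^ 2)))⌉₊

/-- The clipping parameter of run `t`, with `C = √5`: `C R_t / (8 ln (4 N₀ τ / β))` for
`R_t = R / 2 ^ (t / 2)`, real exponent. -/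
def clipParam (R β : ℝ) (N₀ τ : ℕ) (t : ℕ) : ℝ :=
  √5 * R / (8 * (2 : ℝ) ^ ((t : ℝ) / 2) * logTerm N₀ τ β)

/-- The output of `τ` runs of R-clipped-SSTM with the batch sizes `batchSize` and the clipping
parameters `clipParam`. -/
def output {n : ℕ} {S : Type*}
    (g : EuclideanSpace ℝ (Fin n) → S → EuclideanSpace ℝ (Fin n)) (L a σ R β : ℝ) (N₀ τ : ℕ)
    (s : ℕ → ℕ → ℕ → S) (x₀ : EuclideanSpace ℝ (Fin n)) : EuclideanSpace ℝ (Fin n) :=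
  restartedSSTM g L a N₀ (clipParam R β N₀ τ) (batchSize L a σ R β N₀ τ) s x₀ τ

end

end ClippedSSTM

open ClippedSSTM

/-!
In state `(y, z)` after `k` iterations, let `V = ‖z - x⋆‖² + 2 A_k (f y - f x⋆)`, and let `ρ²` be
five times the bound on `‖z - x⋆‖²` at the start of the run. One iteration raises `V` by at most a
term linear in the gradient error plus a term quadratic in it. While `V ≤ ρ²`, the gradient at the
next query point is at most half the clipping level. Hence the clipped error is bounded by a
multiple of that level, and its bias, arising only where the noise exceeds half the level, is at
most the variance divided by a multiple of it. So the exponent `2 l V / ρ²`, with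
`l = logTerm N₀ τ β`, has small enough increments for `exp u ≤ 1 + u + u²` to apply, and with the
given batch sizes the exponential grows in mean by a factor of at most `exp (l / (2 N₀))` per
iteration. It starts below `exp (2 l / 5)`, and `V > ρ²` means that it exceeds `exp (2 l)`; by a
maximal inequality this happens during a run with probability at most `exp (-l) = β / (4 N₀ τ)`.

When `V ≤ ρ²` at the end of a run, the lower bound on `N₀` makes `A_{N₀}` large enough for the gap
`f - f x⋆` to have been halved; by strong convexity the next run then starts in a ball with half the
squared radius. A union bound over the `τ` runs gives the first part.

For the complexity, `N₀` is of order `√(a L / μ)` and `a` of order `l²`, so `l` satisfies an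
inequality `l ≤ c + log l`, which makes it a multiple of `log (L / (μ β) * log (μ R² / ε))`. An
admissible `N₀` exists because `√a` grows only logarithmically in `N₀`; the least `N₀` above its
lower bound exceeds that bound by a factor of at most `2`.
-/

namespace ClippedSSTM

/-! ### Smooth and strongly convex functions -/

section Convexity

variable {E : Type*} [NormedAddCommGroup E] [InnerProductSpace ℝ E] [CompleteSpace E]
  {f : E → ℝ} {L : ℝ}

lemma hasDerivAt_comp_add_smul (hf : Differentiable ℝ f) (x d : E) (t : ℝ) :
    HasDerivAt (fun t : ℝ ↦ f (x + t • d)) (inner ℝ (∇ f (x + t • d)) d) t := by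
  rw [inner_gradient_left]
  refine (hf _).hasFDerivAt.comp_hasDerivAt t ?_
  simpa using ((hasDerivAt_id t).smul_const d).const_add x

lemma le_quadratic_of_lipschitz_gradient (hf : Differentiable ℝ f)
    (hlip : ∀ x y, ‖∇ f x - ∇ f y‖ ≤ L * ‖x - y‖) (x y : E) :
    f x ≤ f y + inner ℝ (∇ f y) (x - y) + L / 2 * ‖x - y‖ ^ 2 := by
  set d := x - y with hd
  set φ : ℝ → ℝ := fun t ↦ f (y + t • d) - t * inner ℝ (∇ f y) d - L / 2 * ‖d‖ ^ 2 * t ^ 2 with hφ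
  have hderiv (t : ℝ) : HasDerivAt φ
      (inner ℝ (∇ f (y + t • d)) d - inner ℝ (∇ f y) d - L * ‖d‖ ^ 2 * t) t := by
    refine (((hasDerivAt_comp_add_smul hf y d t).sub ((hasDerivAt_id' t).mul_const _)).sub
      ((hasDerivAt_pow 2 t).const_mul (L / 2 * ‖d‖ ^ 2))).congr_deriv ?_
    push_cast
    ring
  have hanti : AntitoneOn φ (Set.Ici 0) := by
    refine antitoneOn_of_deriv_nonpos (convex_Ici 0)
      (fun t _ ↦ (hderiv t).continuousAt.continuousWithinAt)
      (fun t _ ↦ (hderiv t).differentiableAt.differentiableWithinAt) fun t ht ↦ ?_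
    rw [interior_Ici, Set.mem_Ioi] at ht
    have hgrad : ‖∇ f (y + t • d) - ∇ f y‖ ≤ L * (t * ‖d‖) := by
      simpa [norm_smul, abs_of_pos ht] using hlip (y + t • d) y
    rw [(hderiv t).deriv, ← inner_sub_left]
    nlinarith [real_inner_le_norm (∇ f (y + t • d) - ∇ f y) d,
      mul_le_mul_of_nonneg_right hgrad (norm_nonneg d)]
  have h : φ 1 ≤ φ 0 := hanti Set.self_mem_Ici (Set.mem_Ici.2 zero_le_one) zero_le_one
  simp only [hφ, one_smul, zero_smul, hd, add_sub_cancel, add_zero] at h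
  linarith

lemma norm_gradient_sq_le_of_le_quadratic (hL : 0 < L)
    (hquad : ∀ x y, f x ≤ f y + inner ℝ (∇ f y) (x - y) + L / 2 * ‖x - y‖ ^ 2)
    {c : ℝ} (hc : ∀ x, c ≤ f x) (x : E) : ‖∇ f x‖ ^ 2 ≤ 2 * L * (f x - c) := by
  have h := (hc _).trans (hquad (x - L⁻¹ • ∇ f x) x)
  rw [sub_sub_cancel_left, inner_neg_right, inner_smul_right, real_inner_self_eq_norm_sq,
    norm_neg, norm_smul, Real.norm_eq_abs, abs_of_pos (inv_pos.2 hL)] at h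
  field_simp at h
  linarith

end Convexity

section StrongConvexity

variable {n : ℕ} {f : EuclideanSpace ℝ (Fin n) → ℝ} {μ L : ℝ}

lemma IsSmooth.le_quadratic (hf : IsSmooth L f) (x y : EuclideanSpace ℝ (Fin n)) :
    f x ≤ f y + inner ℝ (∇ f y) (x - y) + L / 2 * ‖x - y‖ ^ 2 :=
  le_quadratic_of_lipschitz_gradient hf.1 hf.2 x y

lemma IsStronglyConvex.add_inner_le (hμ : 0 ≤ μ) (hc : IsStronglyConvex μ f)
    (x y : EuclideanSpace ℝ (Fin n)) : f y + inner ℝ (∇ f y) (x - y) ≤ f x := by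
  have : 0 ≤ μ / 2 * ‖x - y‖ ^ 2 := by positivity
  linarith [hc.2 x y]

lemma IsStronglyConvex.norm_sub_sq_le (hμ : 0 < μ) (hc : IsStronglyConvex μ f)
    {xs : EuclideanSpace ℝ (Fin n)} (hxs : ∀ x, f xs ≤ f x) (x : EuclideanSpace ℝ (Fin n)) :
    ‖x - xs‖ ^ 2 ≤ 2 * (f x - f xs) / μ := by
  have hmin : fderiv ℝ f xs = 0 := IsLocalMin.fderiv_eq_zero (Filter.Eventually.of_forall hxs)
  have h := hc.2 x xs
  rw [inner_gradient_left, hmin, zero_apply] at h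
  rw [le_div_iff₀ hμ]
  linarith

lemma IsStronglyConvex.le_of_isSmooth (hc : IsStronglyConvex μ f) (hf : IsSmooth L f)
    {x y : EuclideanSpace ℝ (Fin n)} (hxy : x ≠ y) : μ ≤ L := by
  have hpos : 0 < ‖x - y‖ ^ 2 := pow_pos (norm_pos_iff.2 (sub_ne_zero.2 hxy)) 2
  have h : μ / 2 * ‖x - y‖ ^ 2 ≤ L / 2 * ‖x - y‖ ^ 2 := by
    linarith [hc.2 x y, hf.le_quadratic x y]
  linarith [le_of_mul_le_mul_right h hpos]

end StrongConvexity

/-! ### Clipping -/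

section Clipping

lemma abs_inner_add_norm_sq_le {E : Type*} [NormedAddCommGroup E]
    [InnerProductSpace ℝ E] {r b : ℝ} {θ η : E} (hη : ‖η‖ ≤ r)
    (hθ : ‖θ‖ ≤ b) : |2 * inner ℝ θ η + 2 * ‖θ‖ ^ 2| ≤ 2 * ‖θ‖ * (r + b) :=
  calc |2 * inner ℝ θ η + 2 * ‖θ‖ ^ 2|
      ≤ |2 * inner ℝ θ η| + |2 * ‖θ‖ ^ 2| := abs_add_le _ _
    _ = 2 * |inner ℝ θ η| + 2 * (‖θ‖ * ‖θ‖) := by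
      rw [abs_mul, abs_two, abs_of_nonneg (by positivity : 0 ≤ 2 * ‖θ‖ ^ 2), sq]
    _ ≤ 2 * (‖θ‖ * r) + 2 * (‖θ‖ * b) := by
      gcongr
      exact (abs_real_inner_le_norm θ η).trans (by gcongr)
    _ = 2 * ‖θ‖ * (r + b) := by ring

variable {n : ℕ} {v w : EuclideanSpace ℝ (Fin n)} {lam : ℝ}

lemma norm_clip_le (v : EuclideanSpace ℝ (Fin n)) (hlam : 0 ≤ lam) : ‖clip v lam‖ ≤ lam := by
  rcases eq_or_ne v 0 with rfl | hv
  · simpa [clip] using hlam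
  have hv' := norm_pos_iff.2 hv
  rw [clip, norm_smul, Real.norm_of_nonneg (le_min zero_le_one (by positivity))]
  calc min 1 (lam / ‖v‖) * ‖v‖ ≤ lam / ‖v‖ * ‖v‖ := by gcongr; exact min_le_right _ _
    _ = lam := div_mul_cancel₀ _ hv'.ne'

lemma clip_of_norm_le (h : ‖v‖ ≤ lam) : clip v lam = v := by
  rcases eq_or_ne v 0 with rfl | hv
  · simp [clip]
  rw [clip, min_eq_left ((one_le_div (norm_pos_iff.2 hv)).2 h), one_smul]

lemma clip_zero_right (v : EuclideanSpace ℝ (Fin n)) : clip v 0 = 0 := by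
  simp [clip]

lemma smul_clip {c : ℝ} (hc : 0 < c) (v : EuclideanSpace ℝ (Fin n)) (lam : ℝ) :
    c • clip v (lam / c) = clip (c • v) lam := by
  rw [clip, clip, norm_smul, Real.norm_of_nonneg hc.le, div_div, smul_comm]

lemma norm_clip_sub_of_lt (hlam : 0 ≤ lam) (h : lam < ‖v‖) : ‖clip v lam - v‖ = ‖v‖ - lam := by
  have hv : 0 < ‖v‖ := hlam.trans_lt h
  have hle : lam / ‖v‖ ≤ 1 := (div_le_one hv).2 h.le
  have hsub : clip v lam - v = -((1 - lam / ‖v‖) • v) := by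
    rw [clip, min_eq_right hle, sub_smul, one_smul, neg_sub]
  rw [hsub, norm_neg, norm_smul, Real.norm_of_nonneg (sub_nonneg.2 hle), sub_mul, one_mul,
    div_mul_cancel₀ _ hv.ne']

lemma norm_clip_sub_self_le (hlam : 0 < lam) (hw : ‖w‖ ≤ lam / 2) :
    ‖clip v lam - v‖ ≤ ‖v - w‖ ^ 2 / (2 * lam) := by
  rcases le_or_gt ‖v‖ lam with h | h
  · rw [clip_of_norm_le h, sub_self, norm_zero]
    positivity
  · rw [norm_clip_sub_of_lt hlam.le h, le_div_iff₀ (by positivity)]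
    nlinarith [norm_sub_norm_le v w, sq_nonneg (‖v - w‖ - lam)]

lemma norm_clip_sub_le (hlam : 0 < lam) (hw : ‖w‖ ≤ lam / 2) :
    ‖clip v lam - w‖ ≤ 3 * ‖v - w‖ := by
  rcases le_or_gt ‖v‖ lam with h | h
  · rw [clip_of_norm_le h]
    linarith [norm_nonneg (v - w)]
  · linarith [norm_sub_norm_le v w, norm_sub_le (clip v lam) w, norm_clip_le v hlam.le]

lemma inner_clip_sub_le {r : ℝ} {η : EuclideanSpace ℝ (Fin n)} (hlam : 0 < lam)
    (hw : ‖w‖ ≤ lam / 2) (hη : ‖η‖ ≤ r) :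
    inner ℝ (clip v lam - w) η ≤ inner ℝ (v - w) η + ‖v - w‖ ^ 2 / (2 * lam) * r :=
  calc inner ℝ (clip v lam - w) η
      = inner ℝ (v - w) η + inner ℝ (clip v lam - v) η := by
        rw [← inner_add_left, add_comm, sub_add_sub_cancel]
    _ ≤ inner ℝ (v - w) η + ‖clip v lam - v‖ * ‖η‖ := by gcongr; exact real_inner_le_norm _ _
    _ ≤ inner ℝ (v - w) η + ‖v - w‖ ^ 2 / (2 * lam) * r := by
        gcongr
        exact norm_clip_sub_self_le hlam hw

/-- `exp X ≤ 1 + X + X ^ 2` for `|X| ≤ 1`, and the part of `X` that is linear in the clipping bias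
is already quadratic in `‖v - w‖`. -/
lemma exp_clip_sub_le {s r : ℝ} {η : EuclideanSpace ℝ (Fin n)} (hlam : 0 < lam) (hs : 0 ≤ s)
    (hw : ‖w‖ ≤ lam / 2) (hη : ‖η‖ ≤ r) (hsmall : 3 * s * lam * (r + 3 * lam / 2) ≤ 1) :
    Real.exp (s * (2 * inner ℝ (clip v lam - w) η + 2 * ‖clip v lam - w‖ ^ 2)) ≤
      1 + 2 * s * inner ℝ (v - w) η +
        (s * r / lam + 18 * s + 36 * s ^ 2 * (r + 3 * lam / 2) ^ 2) * ‖v - w‖ ^ 2 := by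
  set θ := clip v lam - w
  set X := s * (2 * inner ℝ θ η + 2 * ‖θ‖ ^ 2) with hX
  have hr : 0 ≤ r := (norm_nonneg η).trans hη
  have hθlam : ‖θ‖ ≤ 3 * lam / 2 := by
    linarith [norm_sub_le (clip v lam) w, norm_clip_le v hlam.le]
  have hθv : ‖θ‖ ≤ 3 * ‖v - w‖ := norm_clip_sub_le hlam hw
  have hXabs : |X| ≤ 2 * s * ‖θ‖ * (r + 3 * lam / 2) :=
    calc |X| = s * |2 * inner ℝ θ η + 2 * ‖θ‖ ^ 2| := by rw [hX, abs_mul, abs_of_nonneg hs]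
      _ ≤ s * (2 * ‖θ‖ * (r + 3 * lam / 2)) := by
        gcongr
        exact abs_inner_add_norm_sq_le hη hθlam
      _ = 2 * s * ‖θ‖ * (r + 3 * lam / 2) := by ring
  have hX_one : |X| ≤ 1 :=
    calc |X| ≤ 2 * s * (3 * lam / 2) * (r + 3 * lam / 2) := hXabs.trans (by gcongr)
      _ = 3 * s * lam * (r + 3 * lam / 2) := by ring
      _ ≤ 1 := hsmall
  have hX_sq : X ^ 2 ≤ 36 * s ^ 2 * (r + 3 * lam / 2) ^ 2 * ‖v - w‖ ^ 2 :=
    calc X ^ 2 = |X| ^ 2 := (sq_abs X).symm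
      _ ≤ (2 * s * (3 * ‖v - w‖) * (r + 3 * lam / 2)) ^ 2 := by
        gcongr
        exact hXabs.trans (by gcongr)
      _ = 36 * s ^ 2 * (r + 3 * lam / 2) ^ 2 * ‖v - w‖ ^ 2 := by ring
  have hX_le : X ≤ 2 * s * inner ℝ (v - w) η + (s * r / lam + 18 * s) * ‖v - w‖ ^ 2 :=
    calc X ≤ s * (2 * (inner ℝ (v - w) η + ‖v - w‖ ^ 2 / (2 * lam) * r)
            + 2 * (3 * ‖v - w‖) ^ 2) := by
          rw [hX]
          gcongr
          exact inner_clip_sub_le hlam hw hη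
      _ = 2 * s * inner ℝ (v - w) η + (s * r / lam + 18 * s) * ‖v - w‖ ^ 2 := by
        field_simp
        ring
  linarith [(abs_le.1 (Real.abs_exp_sub_one_sub_id_le hX_one)).2]

end Clipping

/-! ### Stepsizes -/

section Stepsizes

variable {a L : ℝ}

lemma alpha_succ (a L : ℝ) (k : ℕ) : alpha a L (k + 1) = ((k : ℝ) + 2) / (2 * a * L) := rfl

lemma bigA_succ (a L : ℝ) (k : ℕ) : bigA a L (k + 1) = bigA a L k + alpha a L (k + 1) := rfl

lemma alpha_succ_pos (ha : 0 < a) (hL : 0 < L) (k : ℕ) : 0 < alpha a L (k + 1) := by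
  rw [alpha_succ]
  positivity

lemma bigA_eq (ha : a ≠ 0) (hL : L ≠ 0) (k : ℕ) : bigA a L k = k * (k + 3) / (4 * a * L) := by
  induction k with
  | zero => simp [bigA]
  | succ k ih =>
    rw [bigA_succ, ih, alpha_succ]
    push_cast
    field_simp
    ring

lemma bigA_nonneg (ha : 0 < a) (hL : 0 < L) (k : ℕ) : 0 ≤ bigA a L k := by
  rw [bigA_eq ha.ne' hL.ne']
  positivity

lemma bigA_succ_pos (ha : 0 < a) (hL : 0 < L) (k : ℕ) : 0 < bigA a L (k + 1) := by
  rw [bigA_eq ha.ne' hL.ne']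
  positivity

lemma mul_alpha_sq_le_bigA (ha : 0 < a) (hL : 0 < L) (k : ℕ) :
    a * L * alpha a L (k + 1) ^ 2 ≤ bigA a L (k + 1) :=
  calc a * L * alpha a L (k + 1) ^ 2 = ((k : ℝ) + 2) ^ 2 / (4 * a * L) := by
        rw [alpha_succ]
        field_simp
        ring
    _ ≤ ((k + 1 : ℕ) : ℝ) * ((k + 1 : ℕ) + 3) / (4 * a * L) := by
        gcongr
        push_cast
        linarith [(k.cast_nonneg : (0 : ℝ) ≤ k)]
    _ = bigA a L (k + 1) := (bigA_eq ha.ne' hL.ne' _).symm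

end Stepsizes

/-! ### One iteration -/

noncomputable section Iteration

section Definitions

variable {E : Type*} [AddCommGroup E] [Module ℝ E]

/-- The point `x^{k+1}` at which iteration `k` of clipped-SSTM, in the state `p = (y, z)`,
evaluates the stochastic gradient. -/
def queryPoint (a L : ℝ) (k : ℕ) (p : E × E) : E :=
  (bigA a L (k + 1))⁻¹ • (bigA a L k • p.1 + alpha a L (k + 1) • p.2)

/-- Iteration `k` of an accelerated method with the stepsizes of clipped-SSTM, for an arbitrary
step `d`: the state `p = (y, z)` is moved to `(y', z - d)`. In clipped-SSTM, `d` is `α_{k+1}` times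
the clipped mini-batch gradient. -/
def advance (a L : ℝ) (k : ℕ) (p : E × E) (d : E) : E × E :=
  (queryPoint a L k (p.1, p.2 - d), p.2 - d)

end Definitions

/-- The potential `‖z - x⋆‖² + 2 A_k (f y - f x⋆)` of the state `p = (y, z)` reached after `k`
iterations. -/
def potential {E : Type*} [NormedAddCommGroup E] (a L : ℝ) (f : E → ℝ) (xs : E) (k : ℕ)
    (p : E × E) : ℝ :=
  ‖p.2 - xs‖ ^ 2 + 2 * bigA a L k * (f p.1 - f xs)

/-- The weight `exp (2 l V / ρ²)` of the potential `V`, whose expectation is tracked along a run. It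
is extended-nonnegative, so that its integrals need no integrability side conditions. -/
def expPotential {E : Type*} [NormedAddCommGroup E] (a L l ρ : ℝ) (f : E → ℝ) (xs : E) (k : ℕ)
    (p : E × E) : ENNReal :=
  ENNReal.ofReal (Real.exp (2 * l / ρ ^ 2 * potential a L f xs k p))

/-- Iteration `k` of clipped-SSTM in the state `p = (y, z)`, with clipping parameter `B` and the
batch `s 0, ..., s (m - 1)`. -/
def sstmStep {n : ℕ} {S : Type*} (g : EuclideanSpace ℝ (Fin n) → S → EuclideanSpace ℝ (Fin n))
    (L a B : ℝ) (m k : ℕ) (s : ℕ → S) (p : EuclideanSpace ℝ (Fin n) × EuclideanSpace ℝ (Fin n)) :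
    EuclideanSpace ℝ (Fin n) × EuclideanSpace ℝ (Fin n) :=
  advance a L k p
    (alpha a L (k + 1) • clip (miniBatch g m s (queryPoint a L k p)) (B / alpha a L (k + 1)))

lemma sstm_succ {n : ℕ} {S : Type*}
    (g : EuclideanSpace ℝ (Fin n) → S → EuclideanSpace ℝ (Fin n)) (L a B : ℝ) (m : ℕ → ℕ)
    (s : ℕ → ℕ → S) (x₀ : EuclideanSpace ℝ (Fin n)) (k : ℕ) :
    sstm g L a B m s x₀ (k + 1) = sstmStep g L a B (m k) k (s k) (sstm g L a B m s x₀ k) := rfl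

section QueryPoint

variable {E : Type*} [AddCommGroup E] [Module ℝ E] {a L : ℝ}

lemma bigA_smul_queryPoint (ha : 0 < a) (hL : 0 < L) (k : ℕ) (p : E × E) :
    bigA a L (k + 1) • queryPoint a L k p = bigA a L k • p.1 + alpha a L (k + 1) • p.2 := by
  rw [queryPoint, smul_inv_smul₀ (bigA_succ_pos ha hL k).ne']

lemma bigA_smul_sub_queryPoint (ha : 0 < a) (hL : 0 < L) (k : ℕ) (p : E × E) :
    bigA a L k • (p.1 - queryPoint a L k p) =
      alpha a L (k + 1) • (queryPoint a L k p - p.2) := by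
  have h := bigA_smul_queryPoint ha hL k p
  rw [bigA_succ, add_smul] at h
  rw [smul_sub, smul_sub, sub_eq_sub_iff_add_eq_add, ← h, add_comm]

lemma advance_fst_sub_queryPoint (a L : ℝ) (k : ℕ) (p : E × E) (d : E) :
    (advance a L k p d).1 - queryPoint a L k p =
      -((alpha a L (k + 1) / bigA a L (k + 1)) • d) := by
  simp only [advance, queryPoint]
  module

lemma queryPoint_self (ha : 0 < a) (hL : 0 < L) (k : ℕ) (x : E) :
    queryPoint a L k (x, x) = x := by
  rw [queryPoint, ← add_smul, ← bigA_succ, inv_smul_smul₀ (bigA_succ_pos ha hL k).ne']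

end QueryPoint

section Potential

variable {E : Type*} [NormedAddCommGroup E] {a L : ℝ} {f : E → ℝ} {xs : E} {k : ℕ} {p : E × E}
  {ρ : ℝ}

lemma norm_sub_le_of_potential_le (ha : 0 < a) (hL : 0 < L) (hxs : ∀ x, f xs ≤ f x)
    (hρ : 0 ≤ ρ) (hp : potential a L f xs k p ≤ ρ ^ 2) : ‖p.2 - xs‖ ≤ ρ := by
  have hgap : 0 ≤ 2 * bigA a L k * (f p.1 - f xs) :=
    mul_nonneg (mul_nonneg zero_le_two (bigA_nonneg ha hL k)) (sub_nonneg.2 (hxs p.1))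
  rw [potential] at hp
  exact le_of_sq_le_sq (by linarith) hρ

lemma potential_zero : potential a L f xs 0 p = ‖p.2 - xs‖ ^ 2 := by
  simp [potential, bigA]

lemma expPotential_zero_le {l : ℝ} (hl : 0 ≤ l) (hρ : 0 < ρ) (hp : ‖p.2 - xs‖ ^ 2 ≤ ρ ^ 2 / 5) :
    expPotential a L l ρ f xs 0 p ≤ ENNReal.ofReal (Real.exp (2 * l / 5)) := by
  refine ENNReal.ofReal_le_ofReal (Real.exp_le_exp.2 ?_)
  calc 2 * l / ρ ^ 2 * potential a L f xs 0 p ≤ 2 * l / ρ ^ 2 * (ρ ^ 2 / 5) := by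
        rw [potential_zero]
        gcongr
    _ = 2 * l / 5 := by field_simp

lemma expPotential_le_iff {l : ℝ} (hl : 0 < l) (hρ : 0 < ρ) :
    expPotential a L l ρ f xs k p ≤ ENNReal.ofReal (Real.exp (2 * l)) ↔
      potential a L f xs k p ≤ ρ ^ 2 := by
  rw [expPotential, ENNReal.ofReal_le_ofReal_iff (Real.exp_pos _).le, Real.exp_le_exp,
    div_mul_eq_mul_div, div_le_iff₀ (by positivity), mul_le_mul_iff_of_pos_left (by positivity)]

lemma bigA_mul_gap_le_of_potential_le (hp : potential a L f xs k p ≤ ρ ^ 2) :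
    bigA a L k * (f p.1 - f xs) ≤ ρ ^ 2 / 2 := by
  rw [potential] at hp
  linarith [sq_nonneg ‖p.2 - xs‖]

/-- Since `C = √5`, the bound is half of the gap `μ ρ² / 10` corresponding to the radius
`ρ / √5`. -/
lemma gap_le_of_potential_le {μ : ℝ} {N : ℕ} (hμ : 0 < μ) (hL : 0 < L) (ha : 0 < a)
    (hN : √5 * √(8 * a * L / μ) ≤ N) (hxs : ∀ x, f xs ≤ f x)
    (hp : potential a L f xs N p ≤ ρ ^ 2) : f p.1 - f xs ≤ μ * ρ ^ 2 / 20 := by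
  have hN_sq : 40 * a * L / μ ≤ (N : ℝ) ^ 2 :=
    calc 40 * a * L / μ = (√5 * √(8 * a * L / μ)) ^ 2 := by
          rw [mul_pow, Real.sq_sqrt (by norm_num), Real.sq_sqrt (by positivity)]
          ring
      _ ≤ (N : ℝ) ^ 2 := by gcongr
  have hbigA : 10 / μ ≤ bigA a L N :=
    calc 10 / μ = 40 * a * L / μ / (4 * a * L) := by field_simp; norm_num
      _ ≤ (N : ℝ) * (N + 3) / (4 * a * L) := by
        gcongr
        nlinarith [(N.cast_nonneg : (0 : ℝ) ≤ N)]
      _ = bigA a L N := (bigA_eq ha.ne' hL.ne' N).symm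
  have h : 10 / μ * (f p.1 - f xs) ≤ ρ ^ 2 / 2 :=
    (mul_le_mul_of_nonneg_right hbigA (sub_nonneg.2 (hxs p.1))).trans
      (bigA_mul_gap_le_of_potential_le hp)
  rw [div_mul_eq_mul_div, div_le_iff₀ hμ] at h
  linarith

end Potential

section Descent

variable {E : Type*} [NormedAddCommGroup E] [InnerProductSpace ℝ E] [CompleteSpace E]
  {a L : ℝ} {f : E → ℝ} {xs : E}

lemma bigA_mul_queryPoint_le (ha : 0 < a) (hL : 0 < L)
    (hconv : ∀ x y, f y + inner ℝ (∇ f y) (x - y) ≤ f x) (k : ℕ) (p : E × E) :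
    bigA a L (k + 1) * (f (queryPoint a L k p) - f xs) ≤
      bigA a L k * (f p.1 - f xs) +
        alpha a L (k + 1) * inner ℝ (∇ f (queryPoint a L k p)) (p.2 - xs) := by
  set x := queryPoint a L k p with hx
  set α := alpha a L (k + 1)
  have hy := mul_le_mul_of_nonneg_left (hconv p.1 x) (bigA_nonneg ha hL k)
  have hxs := mul_le_mul_of_nonneg_left (hconv xs x) (alpha_succ_pos ha hL k).le
  have hinner : bigA a L k * inner ℝ (∇ f x) (p.1 - x) + α * inner ℝ (∇ f x) (xs - x) =
      -(α * inner ℝ (∇ f x) (p.2 - xs)) := by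
    rw [← inner_smul_right, bigA_smul_sub_queryPoint ha hL k p, inner_smul_right, ← mul_add,
      ← inner_add_right, ← mul_neg, ← inner_neg_right, ← hx]
    congr 2
    abel
  rw [bigA_succ]
  linarith

lemma bigA_mul_advance_le (ha : 1 ≤ a) (hL : 0 < L)
    (hquad : ∀ x y, f x ≤ f y + inner ℝ (∇ f y) (x - y) + L / 2 * ‖x - y‖ ^ 2)
    (k : ℕ) (p : E × E) (d : E) :
    bigA a L (k + 1) * f (advance a L k p d).1 ≤ bigA a L (k + 1) * f (queryPoint a L k p) -
      alpha a L (k + 1) * inner ℝ (∇ f (queryPoint a L k p)) d + ‖d‖ ^ 2 / 2 := by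
  have ha0 : 0 < a := one_pos.trans_le ha
  have hA := bigA_succ_pos ha0 hL k
  have hstep : L * alpha a L (k + 1) ^ 2 / bigA a L (k + 1) ≤ 1 := by
    rw [div_le_one hA]
    refine le_trans ?_ (mul_alpha_sq_le_bigA ha0 hL k)
    gcongr
    exact le_mul_of_one_le_left hL.le ha
  have h := hquad (advance a L k p d).1 (queryPoint a L k p)
  rw [advance_fst_sub_queryPoint, inner_neg_right, norm_neg, inner_smul_right, norm_smul, mul_pow,
    Real.norm_eq_abs, sq_abs] at h
  set A := bigA a L (k + 1)
  set α := alpha a L (k + 1)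
  set x := queryPoint a L k p
  calc A * f (advance a L k p d).1
      ≤ A * (f x + -(α / A * inner ℝ (∇ f x) d) + L / 2 * ((α / A) ^ 2 * ‖d‖ ^ 2)) := by gcongr
    _ = A * f x - α * inner ℝ (∇ f x) d + L * α ^ 2 / A * (‖d‖ ^ 2 / 2) := by
        field_simp
        ring
    _ ≤ A * f x - α * inner ℝ (∇ f x) d + 1 * (‖d‖ ^ 2 / 2) := by gcongr
    _ = A * f x - α * inner ℝ (∇ f x) d + ‖d‖ ^ 2 / 2 := by rw [one_mul]

lemma potential_advance_le (ha : 1 ≤ a) (hL : 0 < L)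
    (hconv : ∀ x y, f y + inner ℝ (∇ f y) (x - y) ≤ f x)
    (hquad : ∀ x y, f x ≤ f y + inner ℝ (∇ f y) (x - y) + L / 2 * ‖x - y‖ ^ 2)
    (k : ℕ) (p : E × E) (d : E) :
    potential a L f xs (k + 1) (advance a L k p d) ≤ potential a L f xs k p +
      (2 * inner ℝ (d - alpha a L (k + 1) • ∇ f (queryPoint a L k p))
          (xs - p.2 + alpha a L (k + 1) • ∇ f (queryPoint a L k p)) +
        2 * ‖d - alpha a L (k + 1) • ∇ f (queryPoint a L k p)‖ ^ 2) := by
  have hconv_step := bigA_mul_queryPoint_le (xs := xs) (one_pos.trans_le ha) hL hconv k p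
  have hquad_step := bigA_mul_advance_le ha hL hquad k p d
  rw [← real_inner_smul_left] at hconv_step hquad_step
  set w := alpha a L (k + 1) • ∇ f (queryPoint a L k p)
  have hdist : ‖p.2 - d - xs‖ ^ 2 = ‖p.2 - xs‖ ^ 2 - 2 * inner ℝ d (p.2 - xs) + ‖d‖ ^ 2 := by
    rw [sub_right_comm, norm_sub_sq_real, real_inner_comm]
  have hinner : inner ℝ (d - w) (xs - p.2 + w) =
      inner ℝ w (p.2 - xs) - inner ℝ d (p.2 - xs) + inner ℝ w d - ‖w‖ ^ 2 := by
    rw [← neg_sub p.2 xs, inner_add_right, inner_neg_right, inner_sub_left, inner_sub_left,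
      real_inner_self_eq_norm_sq, real_inner_comm d w]
    ring
  simp only [potential]
  change ‖p.2 - d - xs‖ ^ 2 + _ ≤ _
  rw [hdist, hinner, norm_sub_sq_real d w, real_inner_comm w d]
  linarith

lemma mul_alpha_mul_norm_gradient_sq_le (ha : 0 < a) (hL : 0 < L)
    (hconv : ∀ x y, f y + inner ℝ (∇ f y) (x - y) ≤ f x)
    (hquad : ∀ x y, f x ≤ f y + inner ℝ (∇ f y) (x - y) + L / 2 * ‖x - y‖ ^ 2)
    (hxs : ∀ x, f xs ≤ f x) {ρ : ℝ} (hρ : 0 ≤ ρ) {k : ℕ} {p : E × E}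
    (hp : potential a L f xs k p ≤ ρ ^ 2) :
    a * (alpha a L (k + 1) * ‖∇ f (queryPoint a L k p)‖) ^ 2 ≤
      ρ ^ 2 + 2 * (alpha a L (k + 1) * ‖∇ f (queryPoint a L k p)‖) * ρ := by
  have hα := alpha_succ_pos ha hL k
  have hgap := bigA_mul_queryPoint_le (xs := xs) ha hL hconv k p
  have hgrad := norm_gradient_sq_le_of_le_quadratic hL hquad hxs (queryPoint a L k p)
  have hstep := mul_alpha_sq_le_bigA ha hL k
  have hstart := bigA_mul_gap_le_of_potential_le hp
  have hinner : inner ℝ (∇ f (queryPoint a L k p)) (p.2 - xs) ≤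
      ‖∇ f (queryPoint a L k p)‖ * ρ := by
    refine (real_inner_le_norm _ _).trans ?_
    gcongr
    exact norm_sub_le_of_potential_le ha hL hxs hρ hp
  set A := bigA a L (k + 1)
  set α := alpha a L (k + 1)
  set x := queryPoint a L k p
  refine le_of_mul_le_mul_left ?_ hL
  calc L * (a * (α * ‖∇ f x‖) ^ 2) = a * L * α ^ 2 * ‖∇ f x‖ ^ 2 := by ring
    _ ≤ A * (2 * L * (f x - f xs)) :=
        mul_le_mul hstep hgrad (sq_nonneg _) (bigA_succ_pos ha hL k).le
    _ = 2 * L * (A * (f x - f xs)) := by ring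
    _ ≤ 2 * L * (ρ ^ 2 / 2 + α * (‖∇ f x‖ * ρ)) := by
        gcongr
        exact hgap.trans (by gcongr)
    _ = L * (ρ ^ 2 + 2 * (α * ‖∇ f x‖) * ρ) := by ring

lemma alpha_mul_norm_gradient_le (hL : 0 < L)
    (hconv : ∀ x y, f y + inner ℝ (∇ f y) (x - y) ≤ f x)
    (hquad : ∀ x y, f x ≤ f y + inner ℝ (∇ f y) (x - y) + L / 2 * ‖x - y‖ ^ 2)
    (hxs : ∀ x, f xs ≤ f x) {l ρ : ℝ} (hl : 2 ≤ l) (hρ : 0 < ρ) (ha : 576 * l ^ 2 ≤ a) {k : ℕ}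
    {p : E × E} (hp : potential a L f xs k p ≤ ρ ^ 2) :
    alpha a L (k + 1) * ‖∇ f (queryPoint a L k p)‖ ≤ ρ / (16 * l) := by
  have ha0 : 0 < a := (by positivity : 0 < 576 * l ^ 2).trans_le ha
  have h := mul_alpha_mul_norm_gradient_sq_le ha0 hL hconv hquad hxs hρ.le hp
  set u := alpha a L (k + 1) * ‖∇ f (queryPoint a L k p)‖
  rw [le_div_iff₀ (by positivity)]
  by_contra! hu
  have hu0 : 0 < u := pos_of_mul_pos_left (hρ.trans hu) (by positivity)
  refine absurd h (not_le.2 ?_)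
  calc ρ ^ 2 + 2 * u * ρ < (u * (16 * l)) ^ 2 + 2 * u * (u * (16 * l)) := by gcongr
    _ = (256 * l ^ 2 + 32 * l) * u ^ 2 := by ring
    _ ≤ 576 * l ^ 2 * u ^ 2 := by gcongr; nlinarith
    _ ≤ a * u ^ 2 := by gcongr

end Descent

section Numerics

variable {l ρ : ℝ}

lemma tilt_mul_level_le_one (hl : 2 ≤ l) (hρ : 0 < ρ) :
    3 * (2 * l / ρ ^ 2) * (ρ / (8 * l)) * (33 / 32 * ρ + 3 * (ρ / (8 * l)) / 2) ≤ 1 :=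
  calc 3 * (2 * l / ρ ^ 2) * (ρ / (8 * l)) * (33 / 32 * ρ + 3 * (ρ / (8 * l)) / 2)
      ≤ 3 * (2 * l / ρ ^ 2) * (ρ / (8 * l)) * (33 / 32 * ρ + 3 * (ρ / (8 * 2)) / 2) := by gcongr
    _ = 27 / 32 := by field_simp; norm_num
    _ ≤ 1 := by norm_num

lemma tilt_coeff_le (hl : 2 ≤ l) (hρ : 0 < ρ) :
    2 * l / ρ ^ 2 * (33 / 32 * ρ) / (ρ / (8 * l)) + 18 * (2 * l / ρ ^ 2) +
      36 * (2 * l / ρ ^ 2) ^ 2 * (33 / 32 * ρ + 3 * (ρ / (8 * l)) / 2) ^ 2 ≤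
      220 * l ^ 2 / ρ ^ 2 :=
  calc 2 * l / ρ ^ 2 * (33 / 32 * ρ) / (ρ / (8 * l)) + 18 * (2 * l / ρ ^ 2) +
        36 * (2 * l / ρ ^ 2) ^ 2 * (33 / 32 * ρ + 3 * (ρ / (8 * l)) / 2) ^ 2
      ≤ 2 * l / ρ ^ 2 * (33 / 32 * ρ) / (ρ / (8 * l)) + 18 * (2 * l / ρ ^ 2) +
        36 * (2 * l / ρ ^ 2) ^ 2 * (33 / 32 * ρ + 3 * (ρ / (8 * 2)) / 2) ^ 2 := by gcongr
    _ = (198.75 * l ^ 2 + 18 * l * 2) / ρ ^ 2 := by field_simp; ring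
    _ ≤ (198.75 * l ^ 2 + 18 * l * l) / ρ ^ 2 := by gcongr
    _ = 216.75 * l ^ 2 / ρ ^ 2 := by ring
    _ ≤ 220 * l ^ 2 / ρ ^ 2 := by gcongr; norm_num

end Numerics

section ClippedStep

variable {n : ℕ} {a L l ρ : ℝ} {f : EuclideanSpace ℝ (Fin n) → ℝ} {xs : EuclideanSpace ℝ (Fin n)}

lemma exists_exp_potential_advance_clip_le (hL : 0 < L)
    (hconv : ∀ x y, f y + inner ℝ (∇ f y) (x - y) ≤ f x)
    (hquad : ∀ x y, f x ≤ f y + inner ℝ (∇ f y) (x - y) + L / 2 * ‖x - y‖ ^ 2)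
    (hxs : ∀ x, f xs ≤ f x) (hl : 2 ≤ l) (hρ : 0 < ρ) (ha : 576 * l ^ 2 ≤ a) {k : ℕ}
    {p : EuclideanSpace ℝ (Fin n) × EuclideanSpace ℝ (Fin n)}
    (hp : potential a L f xs k p ≤ ρ ^ 2) :
    ∃ c, ∀ v, Real.exp (2 * l / ρ ^ 2 * (potential a L f xs (k + 1) (advance a L k p
          (alpha a L (k + 1) • clip v (ρ / (8 * l) / alpha a L (k + 1))))
        - potential a L f xs k p)) ≤
      1 + inner ℝ (v - ∇ f (queryPoint a L k p)) c +
        220 * l ^ 2 / ρ ^ 2 * alpha a L (k + 1) ^ 2 * ‖v - ∇ f (queryPoint a L k p)‖ ^ 2 := by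
  have : 0 < l := by linarith
  have ha1 : 1 ≤ a := by nlinarith
  have hα := alpha_succ_pos (one_pos.trans_le ha1) hL k
  have hgrad := alpha_mul_norm_gradient_le hL hconv hquad hxs hl hρ ha hp
  have hdescent := potential_advance_le (xs := xs) ha1 hL hconv hquad k p
  set α := alpha a L (k + 1)
  set G := ∇ f (queryPoint a L k p)
  set lam := ρ / (8 * l) with hlam
  have hlam0 : 0 < lam := by positivity
  have hw : ‖α • G‖ ≤ lam / 2 := by
    rw [norm_smul, Real.norm_of_nonneg hα.le, hlam, div_div, mul_right_comm]
    norm_num [hgrad]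
  have hη : ‖xs - p.2 + α • G‖ ≤ 33 / 32 * ρ := by
    have hz := norm_sub_le_of_potential_le (one_pos.trans_le ha1) hL hxs hρ.le hp
    rw [norm_sub_rev] at hz
    have hlam16 : lam ≤ ρ / (8 * 2) := by rw [hlam]; gcongr
    linarith [norm_add_le (xs - p.2) (α • G)]
  refine ⟨(2 * (2 * l / ρ ^ 2) * α) • (xs - p.2 + α • G), fun v ↦ ?_⟩
  rw [smul_clip hα]
  have hmul : α • v - α • G = α • (v - G) := (smul_sub α v G).symm
  calc Real.exp (2 * l / ρ ^ 2 * _)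
      ≤ Real.exp (2 * l / ρ ^ 2 * (2 * inner ℝ (clip (α • v) lam - α • G) (xs - p.2 + α • G)
          + 2 * ‖clip (α • v) lam - α • G‖ ^ 2)) := by
        gcongr
        exact sub_le_iff_le_add'.2 (hdescent _)
    _ ≤ 1 + 2 * (2 * l / ρ ^ 2) * inner ℝ (α • v - α • G) (xs - p.2 + α • G)
          + 220 * l ^ 2 / ρ ^ 2 * ‖α • v - α • G‖ ^ 2 :=
        (exp_clip_sub_le hlam0 (by positivity) hw hη (tilt_mul_level_le_one hl hρ)).trans
          (by gcongr; exact tilt_coeff_le hl hρ)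
    _ = _ := by
        rw [hmul, norm_smul, mul_pow, Real.norm_eq_abs, sq_abs, real_inner_smul_left,
          inner_smul_right]
        ring

end ClippedStep

end Iteration

/-! ### Moments of mini-batch gradients -/

section Moments

variable {Ω : Type*} [MeasurableSpace Ω] {Pr : Measure Ω}

section Hilbert

variable {E : Type*} [NormedAddCommGroup E] [InnerProductSpace ℝ E] [CompleteSpace E]

section Independent

variable [MeasurableSpace E] [BorelSpace E] [IsFiniteMeasure Pr]

lemma integral_norm_sum_sq_of_pairwise_indepFun {ι : Type*} {Y : ι → Ω → E} {s : Finset ι}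
    (hY : ∀ i ∈ s, MemLp (Y i) 2 Pr) (hzero : ∀ i ∈ s, ∫ ω, Y i ω ∂Pr = 0)
    (hind : Set.Pairwise s fun i j ↦ IndepFun (Y i) (Y j) Pr) :
    ∫ ω, ‖∑ i ∈ s, Y i ω‖ ^ 2 ∂Pr = ∑ i ∈ s, ∫ ω, ‖Y i ω‖ ^ 2 ∂Pr := by
  have hY1 (i) (hi : i ∈ s) : Integrable (Y i) Pr := (hY i hi).integrable one_le_two
  have hint (i) (hi : i ∈ s) (j) (hj : j ∈ s) :
      Integrable (fun ω ↦ inner ℝ (Y i ω) (Y j ω)) Pr := by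
    rcases eq_or_ne i j with rfl | hij
    · simpa only [real_inner_self_eq_norm_sq] using (hY i hi).integrable_norm_pow two_ne_zero
    · exact (hind hi hj hij).integrable_bilin (hY1 i hi) (hY1 j hj) (innerSL ℝ)
  have horth (i) (hi : i ∈ s) (j) (hj : j ∈ s) (hij : i ≠ j) :
      ∫ ω, inner ℝ (Y i ω) (Y j ω) ∂Pr = 0 := by
    refine ((hind hi hj hij).integral_bilin (hY1 i hi) (hY1 j hj) (innerSL ℝ)).trans ?_
    rw [hzero i hi, map_zero, zero_apply]
  calc ∫ ω, ‖∑ i ∈ s, Y i ω‖ ^ 2 ∂Pr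
      = ∫ ω, ∑ i ∈ s, ∑ j ∈ s, inner ℝ (Y i ω) (Y j ω) ∂Pr := by
        simp only [← real_inner_self_eq_norm_sq, sum_inner]
        simp only [inner_sum]
    _ = ∑ i ∈ s, ∑ j ∈ s, ∫ ω, inner ℝ (Y i ω) (Y j ω) ∂Pr := by
        rw [integral_finsetSum _ fun i hi ↦ integrable_finsetSum _ fun j hj ↦ hint i hi j hj]
        exact sum_congr rfl fun i hi ↦ integral_finsetSum _ fun j hj ↦ hint i hi j hj
    _ = ∑ i ∈ s, ∫ ω, ‖Y i ω‖ ^ 2 ∂Pr := by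
        refine sum_congr rfl fun i hi ↦ ?_
        rw [sum_eq_single_of_mem i hi fun j hj hji ↦ horth i hi j hj hji.symm]
        simp only [real_inner_self_eq_norm_sq]

lemma integral_norm_average_sq_le {Y : ℕ → Ω → E} (hY : ∀ i, MemLp (Y i) 2 Pr)
    (hzero : ∀ i, ∫ ω, Y i ω ∂Pr = 0) (hind : Pairwise fun i j ↦ IndepFun (Y i) (Y j) Pr) {c : ℝ}
    (hc : ∀ i, ∫ ω, ‖Y i ω‖ ^ 2 ∂Pr ≤ c) (m : ℕ) :
    ∫ ω, ‖(m : ℝ)⁻¹ • ∑ i ∈ range m, Y i ω‖ ^ 2 ∂Pr ≤ c / m := by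
  simp only [norm_smul, mul_pow, norm_inv, Real.norm_natCast]
  rw [integral_const_mul, integral_norm_sum_sq_of_pairwise_indepFun (fun i _ ↦ hY i)
    (fun i _ ↦ hzero i) (hind.set_pairwise _)]
  calc ((m : ℝ)⁻¹) ^ 2 * ∑ i ∈ range m, ∫ ω, ‖Y i ω‖ ^ 2 ∂Pr
      ≤ ((m : ℝ)⁻¹) ^ 2 * (m * c) := by
        gcongr
        simpa using sum_le_card_nsmul (range m) _ c fun i _ ↦ hc i
    _ = c / m := by
        rcases eq_or_ne (m : ℝ) 0 with hm | hm
        · simp [hm]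
        · field_simp

end Independent

lemma lintegral_ofReal_le_of_le_quadratic [IsProbabilityMeasure Pr] {F : Ω → ℝ} {D : Ω → E}
    (hD : MemLp D 2 Pr) (hzero : ∫ ω, D ω ∂Pr = 0) {c : E} {b : ℝ} (hF : ∀ ω, 0 ≤ F ω)
    (hle : ∀ ω, F ω ≤ 1 + inner ℝ (D ω) c + b * ‖D ω‖ ^ 2) :
    ∫⁻ ω, ENNReal.ofReal (F ω) ∂Pr ≤ ENNReal.ofReal (1 + b * ∫ ω, ‖D ω‖ ^ 2 ∂Pr) := by
  have hD1 : Integrable D Pr := hD.integrable one_le_two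
  have hlin : Integrable (fun ω ↦ 1 + inner ℝ (D ω) c) Pr :=
    (integrable_const 1).add (hD1.inner_const c)
  have hsq : Integrable (fun ω ↦ b * ‖D ω‖ ^ 2) Pr :=
    (hD.integrable_norm_pow two_ne_zero).const_mul b
  have hinner : ∫ ω, inner ℝ (D ω) c ∂Pr = 0 := by
    simp only [real_inner_comm c]
    rw [integral_inner hD1 c, hzero, inner_zero_right]
  calc ∫⁻ ω, ENNReal.ofReal (F ω) ∂Pr
      ≤ ∫⁻ ω, ENNReal.ofReal (1 + inner ℝ (D ω) c + b * ‖D ω‖ ^ 2) ∂Pr :=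
        lintegral_mono fun ω ↦ ENNReal.ofReal_le_ofReal (hle ω)
    _ = ENNReal.ofReal (∫ ω, (1 + inner ℝ (D ω) c + b * ‖D ω‖ ^ 2) ∂Pr) :=
        (ofReal_integral_eq_lintegral_ofReal (hlin.add hsq)
          (Filter.Eventually.of_forall fun ω ↦ (hF ω).trans (hle ω))).symm
    _ = ENNReal.ofReal (1 + b * ∫ ω, ‖D ω‖ ^ 2 ∂Pr) := by
        rw [integral_add hlin hsq, integral_add (integrable_const 1) (hD1.inner_const c), hinner,
          integral_const_mul, integral_const, probReal_univ, one_smul, add_zero]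

end Hilbert

section StochasticGradient

variable {n : ℕ} {S : Type*} {g : EuclideanSpace ℝ (Fin n) → S → EuclideanSpace ℝ (Fin n)}

lemma miniBatch_sub_eq {m : ℕ} (hm : m ≠ 0) (s : ℕ → S)
    (x c : EuclideanSpace ℝ (Fin n)) :
    miniBatch g m s x - c = (m : ℝ)⁻¹ • ∑ i ∈ range m, (g x (s i) - c) := by
  rw [miniBatch, sum_sub_distrib, smul_sub, sum_const, card_range, ← Nat.cast_smul_eq_nsmul ℝ,
    inv_smul_smul₀ (Nat.cast_ne_zero.2 hm)]

variable [MeasurableSpace S] {P : Measure S} {σ : ℝ} {f : EuclideanSpace ℝ (Fin n) → ℝ}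
  {ζ : ℕ → Ω → S}

lemma IsStochasticGradient.measurable_sub (hg : IsStochasticGradient P σ f g)
    (x : EuclideanSpace ℝ (Fin n)) : Measurable fun s ↦ g x s - ∇ f x :=
  (hg.measurable.comp measurable_prodMk_left).sub_const _

lemma IsStochasticGradient.memLp_sub (hg : IsStochasticGradient P σ f g)
    (x : EuclideanSpace ℝ (Fin n)) : MemLp (fun s ↦ g x s - ∇ f x) 2 P :=
  (memLp_two_iff_integrable_sq_norm (hg.measurable_sub x).aestronglyMeasurable).2
    (hg.integrable_sq x)

lemma IsStochasticGradient.integral_sub_eq_zero [IsProbabilityMeasure P]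
    (hg : IsStochasticGradient P σ f g) (x : EuclideanSpace ℝ (Fin n)) :
    ∫ s, (g x s - ∇ f x) ∂P = 0 := by
  rw [integral_sub (hg.integrable x) (integrable_const _), hg.unbiased, integral_const,
    probReal_univ, one_smul, sub_self]

lemma IsStochasticGradient.memLp_miniBatch_sub (hg : IsStochasticGradient P σ f g)
    (hζ : ∀ i, MeasurePreserving (ζ i) Pr P) {m : ℕ} (hm : m ≠ 0)
    (x : EuclideanSpace ℝ (Fin n)) :
    MemLp (fun ω ↦ miniBatch g m (fun i ↦ ζ i ω) x - ∇ f x) 2 Pr := by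
  simp only [miniBatch_sub_eq hm]
  have hsum : MemLp (fun ω ↦ ∑ i ∈ range m, (g x (ζ i ω) - ∇ f x)) 2 Pr :=
    memLp_finsetSum _ fun i _ ↦ (hg.memLp_sub x).comp_measurePreserving (hζ i)
  exact hsum.const_smul (m : ℝ)⁻¹

lemma IsStochasticGradient.integral_sample_sub_eq_zero [IsProbabilityMeasure P]
    (hg : IsStochasticGradient P σ f g) {ξ : Ω → S} (hξ : MeasurePreserving ξ Pr P)
    (x : EuclideanSpace ℝ (Fin n)) : ∫ ω, (g x (ξ ω) - ∇ f x) ∂Pr = 0 := by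
  rw [← hg.integral_sub_eq_zero x, ← hξ.map_eq,
    integral_map hξ.aemeasurable (hg.measurable_sub x).aestronglyMeasurable]

lemma IsStochasticGradient.integral_norm_sample_sub_sq_le (hg : IsStochasticGradient P σ f g)
    {ξ : Ω → S} (hξ : MeasurePreserving ξ Pr P) (x : EuclideanSpace ℝ (Fin n)) :
    ∫ ω, ‖g x (ξ ω) - ∇ f x‖ ^ 2 ∂Pr ≤ σ ^ 2 := by
  refine le_of_eq_of_le ?_ (hg.variance_le x)
  rw [← hξ.map_eq, integral_map hξ.aemeasurable
    ((hg.measurable_sub x).norm.pow_const 2).aestronglyMeasurable]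

lemma IsStochasticGradient.integral_miniBatch_sub_eq_zero [IsProbabilityMeasure Pr]
    (hg : IsStochasticGradient P σ f g) (hζ : ∀ i, MeasurePreserving (ζ i) Pr P) {m : ℕ}
    (hm : m ≠ 0) (x : EuclideanSpace ℝ (Fin n)) :
    ∫ ω, (miniBatch g m (fun i ↦ ζ i ω) x - ∇ f x) ∂Pr = 0 := by
  have : IsProbabilityMeasure P := (hζ 0).map_eq ▸
    Measure.isProbabilityMeasure_map (hζ 0).aemeasurable
  have hint (i : ℕ) : Integrable (fun ω ↦ g x (ζ i ω) - ∇ f x) Pr :=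
    ((hg.memLp_sub x).comp_measurePreserving (hζ i)).integrable one_le_two
  simp only [miniBatch_sub_eq hm]
  rw [integral_smul, integral_finsetSum _ fun i _ ↦ hint i,
    sum_eq_zero fun i _ ↦ hg.integral_sample_sub_eq_zero (hζ i) x, smul_zero]

lemma IsStochasticGradient.integral_norm_miniBatch_sub_sq_le [IsProbabilityMeasure Pr]
    (hg : IsStochasticGradient P σ f g) (hζ : ∀ i, MeasurePreserving (ζ i) Pr P)
    (hind : Pairwise fun i j ↦ IndepFun (ζ i) (ζ j) Pr) {m : ℕ} (hm : m ≠ 0)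
    (x : EuclideanSpace ℝ (Fin n)) :
    ∫ ω, ‖miniBatch g m (fun i ↦ ζ i ω) x - ∇ f x‖ ^ 2 ∂Pr ≤ σ ^ 2 / m := by
  have : IsProbabilityMeasure P := (hζ 0).map_eq ▸
    Measure.isProbabilityMeasure_map (hζ 0).aemeasurable
  simp only [miniBatch_sub_eq hm]
  exact integral_norm_average_sq_le
    (fun i ↦ (hg.memLp_sub x).comp_measurePreserving (hζ i))
    (fun i ↦ hg.integral_sample_sub_eq_zero (hζ i) x)
    (fun i j hij ↦ (hind hij).comp (hg.measurable_sub x) (hg.measurable_sub x))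
    (fun i ↦ hg.integral_norm_sample_sub_sq_le (hζ i) x) m

lemma lintegral_expPotential_sstmStep_le [IsProbabilityMeasure Pr] {a L l ρ c : ℝ}
    {xs : EuclideanSpace ℝ (Fin n)} (hL : 0 < L)
    (hconv : ∀ x y, f y + inner ℝ (∇ f y) (x - y) ≤ f x)
    (hquad : ∀ x y, f x ≤ f y + inner ℝ (∇ f y) (x - y) + L / 2 * ‖x - y‖ ^ 2)
    (hxs : ∀ x, f xs ≤ f x) (hg : IsStochasticGradient P σ f g)
    (hζ : ∀ i, MeasurePreserving (ζ i) Pr P) (hind : Pairwise fun i j ↦ IndepFun (ζ i) (ζ j) Pr)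
    (hl : 2 ≤ l) (hρ : 0 < ρ) (ha : 576 * l ^ 2 ≤ a) {m : ℕ} (hm : m ≠ 0) {k : ℕ}
    (hbatch : 220 * l ^ 2 / ρ ^ 2 * alpha a L (k + 1) ^ 2 * (σ ^ 2 / m) ≤ c)
    {p : EuclideanSpace ℝ (Fin n) × EuclideanSpace ℝ (Fin n)}
    (hp : potential a L f xs k p ≤ ρ ^ 2) :
    ∫⁻ ω, expPotential a L l ρ f xs (k + 1)
        (sstmStep g L a (ρ / (8 * l)) m k (fun i ↦ ζ i ω) p) ∂Pr ≤
      ENNReal.ofReal (Real.exp c) * expPotential a L l ρ f xs k p := by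
  simp only [expPotential]
  set x := queryPoint a L k p
  set V := potential a L f xs k p
  set V' : Ω → ℝ := fun ω ↦ potential a L f xs (k + 1)
    (sstmStep g L a (ρ / (8 * l)) m k (fun i ↦ ζ i ω) p)
  set b := 220 * l ^ 2 / ρ ^ 2 * alpha a L (k + 1) ^ 2
  obtain ⟨η, hη⟩ := exists_exp_potential_advance_clip_le hL hconv hquad hxs hl hρ ha hp
  have hstep : ∫⁻ ω, ENNReal.ofReal (Real.exp (2 * l / ρ ^ 2 * (V' ω - V))) ∂Pr ≤
      ENNReal.ofReal (Real.exp c) :=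
    calc _ ≤ ENNReal.ofReal
          (1 + b * ∫ ω, ‖miniBatch g m (fun i ↦ ζ i ω) x - ∇ f x‖ ^ 2 ∂Pr) :=
        lintegral_ofReal_le_of_le_quadratic (hg.memLp_miniBatch_sub hζ hm x)
          (hg.integral_miniBatch_sub_eq_zero hζ hm x) (fun ω ↦ (Real.exp_pos _).le)
          fun ω ↦ hη (miniBatch g m (fun i ↦ ζ i ω) x)
      _ ≤ ENNReal.ofReal (1 + b * (σ ^ 2 / m)) := by
        gcongr
        exact hg.integral_norm_miniBatch_sub_sq_le hζ hind hm x
      _ ≤ ENNReal.ofReal (Real.exp c) := by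
        gcongr
        linarith [Real.add_one_le_exp c]
  have hsplit (ω : Ω) : ENNReal.ofReal (Real.exp (2 * l / ρ ^ 2 * V' ω)) =
      ENNReal.ofReal (Real.exp (2 * l / ρ ^ 2 * (V' ω - V))) *
        ENNReal.ofReal (Real.exp (2 * l / ρ ^ 2 * V)) := by
    rw [← ENNReal.ofReal_mul (Real.exp_pos _).le, ← Real.exp_add, ← mul_add, sub_add_cancel]
  rw [lintegral_congr hsplit, lintegral_mul_const' _ _ ENNReal.ofReal_ne_top]
  gcongr

end StochasticGradient

end Moments

/-! ### A maximal inequality and conditioning -/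

section Maximal

open scoped ENNReal

variable {Ω : Type*}

/-- The event that the process `W` does not exceed the level `e` up to time `k`. -/
def staysBelow (W : ℕ → Ω → ℝ≥0∞) (e : ℝ≥0∞) (k : ℕ) : Set Ω :=
  {ω | ∀ j ≤ k, W j ω ≤ e}

lemma staysBelow_zero (W : ℕ → Ω → ℝ≥0∞) (e : ℝ≥0∞) :
    staysBelow W e 0 = {ω | W 0 ω ≤ e} := by
  ext ω
  simp [staysBelow]

lemma staysBelow_succ (W : ℕ → Ω → ℝ≥0∞) (e : ℝ≥0∞) (k : ℕ) :
    staysBelow W e (k + 1) = {ω | W (k + 1) ω ≤ e} ∩ staysBelow W e k := by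
  ext ω
  simp [staysBelow, Nat.le_succ_iff_eq_or_le, or_imp, forall_and]

lemma measurableSet_staysBelow {m : MeasurableSpace Ω} {W : ℕ → Ω → ℝ≥0∞} (e : ℝ≥0∞) {k : ℕ}
    (hW : ∀ j ≤ k, Measurable[m] (W j)) : MeasurableSet[m] (staysBelow W e k) := by
  have h : staysBelow W e k = ⋂ j ∈ Set.Iic k, W j ⁻¹' Set.Iic e := by
    ext ω
    simp [staysBelow]
  rw [h]
  exact .biInter (Set.to_countable _) fun j hj ↦ hW j hj measurableSet_Iic

variable [MeasurableSpace Ω] {μ : Measure Ω}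

lemma setLIntegral_add_mul_measure_compl_le {W : Ω → ℝ≥0∞} (hW : Measurable W) (e : ℝ≥0∞) :
    ∫⁻ ω in {ω | W ω ≤ e}, W ω ∂μ + e * μ {ω | W ω ≤ e}ᶜ ≤ ∫⁻ ω, W ω ∂μ := by
  have hmeas : MeasurableSet {ω | W ω ≤ e} := hW measurableSet_Iic
  calc ∫⁻ ω in {ω | W ω ≤ e}, W ω ∂μ + e * μ {ω | W ω ≤ e}ᶜ
      ≤ ∫⁻ ω in {ω | W ω ≤ e}, W ω ∂μ + ∫⁻ ω in {ω | W ω ≤ e}ᶜ, W ω ∂μ := by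
        rw [← setLIntegral_const]
        exact add_le_add le_rfl (setLIntegral_mono' hmeas.compl fun ω hω ↦
          (not_le.1 (Set.notMem_ofPred_iff.1 hω)).le)
    _ = ∫⁻ ω, W ω ∂μ := lintegral_add_compl W hmeas

/-- The expectations need to be controlled only as long as the process has not exceeded `e`. -/
lemma setLIntegral_staysBelow_add_le {W : ℕ → Ω → ℝ≥0∞} (hW : ∀ k, Measurable (W k))
    {q e : ℝ≥0∞} (hq : 1 ≤ q)
    (hstep : ∀ k, ∫⁻ ω in staysBelow W e k, W (k + 1) ω ∂μ ≤
      q * ∫⁻ ω in staysBelow W e k, W k ω ∂μ) (N : ℕ) :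
    ∫⁻ ω in staysBelow W e N, W N ω ∂μ + e * μ (staysBelow W e N)ᶜ ≤
      q ^ N * ∫⁻ ω, W 0 ω ∂μ := by
  induction N with
  | zero =>
    rw [staysBelow_zero, pow_zero, one_mul]
    exact setLIntegral_add_mul_measure_compl_le (hW 0) e
  | succ k ih =>
    set D := staysBelow W e k
    set T := {ω | W (k + 1) ω ≤ e}
    have hT : MeasurableSet T := hW (k + 1) measurableSet_Iic
    have hsplit := setLIntegral_add_mul_measure_compl_le (μ := μ.restrict D) (hW (k + 1)) e
    rw [Measure.restrict_restrict hT, Measure.restrict_apply hT.compl] at hsplit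
    have hcompl : μ (T ∩ D)ᶜ ≤ μ (Tᶜ ∩ D) + μ Dᶜ := by
      refine (measure_mono fun ω hω ↦ ?_).trans (measure_union_le _ _)
      by_cases hD : ω ∈ D
      · exact Or.inl ⟨fun hωT ↦ hω ⟨hωT, hD⟩, hD⟩
      · exact Or.inr hD
    rw [staysBelow_succ]
    calc ∫⁻ ω in T ∩ D, W (k + 1) ω ∂μ + e * μ (T ∩ D)ᶜ
        ≤ ∫⁻ ω in T ∩ D, W (k + 1) ω ∂μ + e * (μ (Tᶜ ∩ D) + μ Dᶜ) := by gcongr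
      _ = (∫⁻ ω in T ∩ D, W (k + 1) ω ∂μ + e * μ (Tᶜ ∩ D)) + e * μ Dᶜ := by
        rw [mul_add, add_assoc]
      _ ≤ q * ∫⁻ ω in D, W k ω ∂μ + q * (e * μ Dᶜ) :=
        add_le_add (hsplit.trans (hstep k)) (le_mul_of_one_le_left' hq)
      _ ≤ q * (q ^ k * ∫⁻ ω, W 0 ω ∂μ) := by
        rw [← mul_add]
        gcongr
      _ = q ^ (k + 1) * ∫⁻ ω, W 0 ω ∂μ := by rw [pow_succ', mul_assoc]

lemma mul_measure_lt_le_of_setLIntegral_le {W : ℕ → Ω → ℝ≥0∞} (hW : ∀ k, Measurable (W k))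
    {q e : ℝ≥0∞} (hq : 1 ≤ q)
    (hstep : ∀ k, ∫⁻ ω in staysBelow W e k, W (k + 1) ω ∂μ ≤
      q * ∫⁻ ω in staysBelow W e k, W k ω ∂μ) (N : ℕ) :
    e * μ {ω | e < W N ω} ≤ q ^ N * ∫⁻ ω, W 0 ω ∂μ :=
  calc e * μ {ω | e < W N ω} ≤ e * μ (staysBelow W e N)ᶜ := by
        gcongr
        exact fun ω hω h ↦ (h N le_rfl).not_gt hω
    _ ≤ q ^ N * ∫⁻ ω, W 0 ω ∂μ :=
        le_add_self.trans (setLIntegral_staysBelow_add_le hW hq hstep N)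

lemma measure_compl_le_mul {G : ℕ → Set Ω} {p : ℝ≥0∞} (h0 : G 0 = Set.univ)
    (hG : ∀ t, μ (G t \ G (t + 1)) ≤ p) (τ : ℕ) : μ (G τ)ᶜ ≤ τ * p := by
  induction τ with
  | zero => simp [h0]
  | succ t ih =>
    have hsub : (G (t + 1))ᶜ ⊆ (G t)ᶜ ∪ G t \ G (t + 1) := fun ω hω ↦
      (em (ω ∈ G t)).elim (fun h ↦ Or.inr ⟨h, hω⟩) Or.inl
    calc μ (G (t + 1))ᶜ ≤ μ (G t)ᶜ + μ (G t \ G (t + 1)) :=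
          (measure_mono hsub).trans (measure_union_le _ _)
      _ ≤ t * p + p := add_le_add ih (hG t)
      _ = (t + 1 : ℕ) * p := by rw [Nat.cast_succ, add_mul, one_mul]

end Maximal

section Conditioning

open scoped ENNReal

variable {Ω A T : Type*} {m mΩ : MeasurableSpace Ω} {μ : Measure Ω} [IsFiniteMeasure μ]
  [MeasurableSpace A] [mT : MeasurableSpace T] {U : Ω → A} {b : Ω → T} {G : A × T → ℝ≥0∞}

lemma lintegral_comp_prod_of_indepFun (hU : Measurable U) (hb : Measurable b)
    (hind : IndepFun U b μ) (hG : Measurable G) :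
    ∫⁻ ω, G (U ω, b ω) ∂μ = ∫⁻ ω, ∫⁻ ω', G (U ω, b ω') ∂μ ∂μ :=
  calc ∫⁻ ω, G (U ω, b ω) ∂μ = ∫⁻ q, G q ∂(μ.map fun ω ↦ (U ω, b ω)) :=
        (lintegral_map hG (hU.prodMk hb)).symm
    _ = ∫⁻ u, ∫⁻ y, G (u, y) ∂(μ.map b) ∂(μ.map U) := by
        rw [hind.map_prod_eq_prod_map_map hU.aemeasurable hb.aemeasurable,
          lintegral_prod _ hG.aemeasurable]
    _ = ∫⁻ ω, ∫⁻ y, G (U ω, y) ∂(μ.map b) ∂μ := lintegral_map hG.lintegral_prod_right' hU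
    _ = ∫⁻ ω, ∫⁻ ω', G (U ω, b ω') ∂μ ∂μ :=
        lintegral_congr fun ω ↦ lintegral_map (hG.comp measurable_prodMk_left) hb

lemma setLIntegral_comp_prod_of_indep {D : Set Ω} (hm : m ≤ mΩ) (hD : MeasurableSet[m] D)
    (hU : Measurable[m] U) (hb : Measurable b) (hind : Indep m (mT.comap b) μ)
    (hG : Measurable G) :
    ∫⁻ ω in D, G (U ω, b ω) ∂μ = ∫⁻ ω in D, ∫⁻ ω', G (U ω, b ω') ∂μ ∂μ := by
  have hone : Measurable[m] (1 : Ω → ℝ≥0∞) := @measurable_const _ _ _ m 1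
  set U' : Ω → ℝ≥0∞ × A := fun ω ↦ (D.indicator 1 ω, U ω)
  have hU' : Measurable[m] U' := (hone.indicator hD).prodMk hU
  have hmul (F : Ω → ℝ≥0∞) : ∫⁻ ω in D, F ω ∂μ = ∫⁻ ω, D.indicator 1 ω * F ω ∂μ := by
    rw [← lintegral_indicator (hm D hD)]
    exact lintegral_congr fun ω ↦ by by_cases h : ω ∈ D <;> simp [h]
  have hcond := lintegral_comp_prod_of_indepFun (μ := μ) (hU'.mono hm le_rfl) hb
    ((IndepFun_iff_Indep _ _ _).2 (indep_of_indep_of_le_left hind hU'.comap_le))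
    (G := fun q ↦ q.1.1 * G (q.1.2, q.2)) (by fun_prop)
  rw [hmul, hmul, hcond]
  exact lintegral_congr fun ω ↦ lintegral_const_mul _ (by fun_prop)

end Conditioning

/-! ### Measurability and independence of the iterates -/

section Measurability

variable {n : ℕ} {S Ω : Type*} [MeasurableSpace S]
  {g : EuclideanSpace ℝ (Fin n) → S → EuclideanSpace ℝ (Fin n)}

lemma measurable_clip (lam : ℝ) : Measurable fun v : EuclideanSpace ℝ (Fin n) ↦ clip v lam := by
  unfold clip
  fun_prop

lemma measurable_queryPoint (a L : ℝ) (k : ℕ) :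
    Measurable (queryPoint (E := EuclideanSpace ℝ (Fin n)) a L k) := by
  unfold queryPoint
  fun_prop

lemma measurable_advance (a L : ℝ) (k : ℕ) :
    Measurable fun q : (EuclideanSpace ℝ (Fin n) × EuclideanSpace ℝ (Fin n)) ×
      EuclideanSpace ℝ (Fin n) ↦ advance a L k q.1 q.2 := by
  have hquery := measurable_queryPoint (n := n) a L k
  unfold advance
  fun_prop

lemma measurable_miniBatch (hg : Measurable (Function.uncurry g)) (m : ℕ) :
    Measurable fun q : EuclideanSpace ℝ (Fin n) × (ℕ → S) ↦ miniBatch g m q.2 q.1 := by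
  have hterm (i : ℕ) : Measurable fun q : EuclideanSpace ℝ (Fin n) × (ℕ → S) ↦ g q.1 (q.2 i) :=
    hg.comp (measurable_fst.prodMk ((measurable_pi_apply i).comp measurable_snd))
  exact (measurable_fun_sum _ fun i _ ↦ hterm i).const_smul (m : ℝ)⁻¹

lemma measurable_sstmStep (hg : Measurable (Function.uncurry g)) (L a B : ℝ) (m k : ℕ) :
    Measurable fun q : (EuclideanSpace ℝ (Fin n) × EuclideanSpace ℝ (Fin n)) × (ℕ → S) ↦
      sstmStep g L a B m k q.2 q.1 := by
  have hgrad : Measurable fun q : (EuclideanSpace ℝ (Fin n) × EuclideanSpace ℝ (Fin n)) ×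
      (ℕ → S) ↦ miniBatch g m q.2 (queryPoint a L k q.1) :=
    (measurable_miniBatch hg m).comp
      (((measurable_queryPoint a L k).comp measurable_fst).prodMk measurable_snd)
  have hclip := ((measurable_clip (B / alpha a L (k + 1))).comp hgrad).const_smul
    (alpha a L (k + 1))
  have hstep := (measurable_advance a L k).comp (measurable_fst.prodMk hclip)
  exact hstep

lemma measurable_sstm [MeasurableSpace Ω] (hg : Measurable (Function.uncurry g)) (L a B : ℝ)
    (m : ℕ → ℕ) {ζ : ℕ → ℕ → Ω → S} {X : Ω → EuclideanSpace ℝ (Fin n)} (hX : Measurable X)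
    {N : ℕ} (hζ : ∀ k < N, ∀ i, Measurable (ζ k i)) :
    Measurable fun ω ↦ sstm g L a B m (fun k i ↦ ζ k i ω) (X ω) N := by
  induction N with
  | zero => exact hX.prodMk hX
  | succ N ih =>
    have hstate := ih fun k hk ↦ hζ k (hk.trans N.lt_succ_self)
    have hbatch : Measurable fun ω i ↦ ζ N i ω := measurable_pi_iff.2 (hζ N N.lt_succ_self)
    have hstep := (measurable_sstmStep hg L a B (m N) N).comp (hstate.prodMk hbatch)
    simp only [sstm_succ]
    exact hstep

lemma measurable_potential (a L : ℝ) {f : EuclideanSpace ℝ (Fin n) → ℝ} (hf : Measurable f)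
    (xs : EuclideanSpace ℝ (Fin n)) (k : ℕ) : Measurable (potential a L f xs k) := by
  unfold potential
  fun_prop

lemma measurable_expPotential (a L l ρ : ℝ) {f : EuclideanSpace ℝ (Fin n) → ℝ}
    (hf : Measurable f) (xs : EuclideanSpace ℝ (Fin n)) (k : ℕ) :
    Measurable (expPotential a L l ρ f xs k) :=
  ((measurable_potential a L hf xs k).const_mul _).exp.ennreal_ofReal

/-- The σ-algebra generated by the samples drawn before iteration `k` of run `t`. -/
@[reducible]
def pastSigma (ξ : ℕ → ℕ → ℕ → Ω → S) (t k : ℕ) : MeasurableSpace Ω :=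
  ⨆ p ∈ {p : ℕ × ℕ × ℕ | p.1 < t ∨ p.1 = t ∧ p.2.1 < k},
    MeasurableSpace.comap (ξ p.1 p.2.1 p.2.2) inferInstance

lemma measurable_pastSigma {ξ : ℕ → ℕ → ℕ → Ω → S} {t k t' k' : ℕ}
    (h : t' < t ∨ t' = t ∧ k' < k) (i : ℕ) : Measurable[pastSigma ξ t k] (ξ t' k' i) :=
  (comap_measurable (ξ t' k' i)).mono
    (le_biSup (fun p : ℕ × ℕ × ℕ ↦ MeasurableSpace.comap (ξ p.1 p.2.1 p.2.2) inferInstance)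
      (i := (t', k', i)) h) le_rfl

lemma pastSigma_mono {ξ : ℕ → ℕ → ℕ → Ω → S} {t k t' k' : ℕ} (h : t' < t ∨ t' = t ∧ k' ≤ k) :
    pastSigma ξ t' k' ≤ pastSigma ξ t k := by
  refine biSup_mono fun p hp ↦ ?_
  simp only [Set.mem_ofPred_eq] at hp ⊢
  omega

lemma measurable_sstm_pastSigma {ξ : ℕ → ℕ → ℕ → Ω → S} (hg : Measurable (Function.uncurry g))
    (L a B : ℝ) (m : ℕ → ℕ) {t : ℕ} {X : Ω → EuclideanSpace ℝ (Fin n)}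
    (hX : Measurable[pastSigma ξ t 0] X) (k : ℕ) :
    Measurable[pastSigma ξ t k] fun ω ↦ sstm g L a B m (fun k i ↦ ξ t k i ω) (X ω) k :=
  @measurable_sstm n S Ω _ g (pastSigma ξ t k) hg L a B m (ξ t) X
    (hX.mono (pastSigma_mono (Or.inr ⟨rfl, k.zero_le⟩)) le_rfl) k
    fun _ hj ↦ measurable_pastSigma (Or.inr ⟨rfl, hj⟩)

lemma measurable_restartedSSTM {ξ : ℕ → ℕ → ℕ → Ω → S} (hg : Measurable (Function.uncurry g))
    (L a : ℝ) (N₀ : ℕ) (B : ℕ → ℝ) (m : ℕ → ℕ → ℕ) (x₀ : EuclideanSpace ℝ (Fin n)) (t : ℕ) :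
    Measurable[pastSigma ξ t 0]
      fun ω ↦ restartedSSTM g L a N₀ B m (fun t k i ↦ ξ t k i ω) x₀ t := by
  induction t with
  | zero => exact @measurable_const _ _ _ (pastSigma ξ 0 0) _
  | succ t ih =>
    have hrun := (measurable_sstm_pastSigma hg L a (B t) (m t) ih N₀).mono
      (pastSigma_mono (t := t + 1) (k := 0) (Or.inl t.lt_succ_self)) le_rfl
    exact measurable_fst.comp hrun

variable [MeasurableSpace Ω] {Pr : Measure Ω} {P : Measure S} {ξ : ℕ → ℕ → ℕ → Ω → S}

lemma IsIIDSample.measurePreserving (hξ : IsIIDSample Pr P ξ) (t k i : ℕ) :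
    MeasurePreserving (ξ t k i) Pr P :=
  ⟨hξ.measurable t k i, hξ.law t k i⟩

lemma IsIIDSample.pairwise_indepFun (hξ : IsIIDSample Pr P ξ) (t k : ℕ) :
    Pairwise fun i j ↦ IndepFun (ξ t k i) (ξ t k j) Pr := fun i j hij ↦
  hξ.indep.indepFun (i := (t, k, i)) (j := (t, k, j)) (by simpa using hij)

lemma IsIIDSample.pastSigma_le (hξ : IsIIDSample Pr P ξ) (t k : ℕ) :
    pastSigma ξ t k ≤ (inferInstance : MeasurableSpace Ω) :=
  iSup₂_le fun _ _ ↦ (hξ.measurable _ _ _).comap_le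

lemma IsIIDSample.indep_pastSigma (hξ : IsIIDSample Pr P ξ) (t k : ℕ) :
    Indep (pastSigma ξ t k) (MeasurableSpace.comap (fun ω i ↦ ξ t k i ω) inferInstance) Pr := by
  have hdisj : Disjoint {p : ℕ × ℕ × ℕ | p.1 < t ∨ p.1 = t ∧ p.2.1 < k}
      {p : ℕ × ℕ × ℕ | p.1 = t ∧ p.2.1 = k} := by
    rw [Set.disjoint_left]
    intro p hpast hnow
    simp only [Set.mem_ofPred_eq] at hpast hnow
    omega
  have hindep := indep_iSup_of_disjoint
    (fun p : ℕ × ℕ × ℕ ↦ (hξ.measurable p.1 p.2.1 p.2.2).comap_le)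
    ((iIndepFun_iff_iIndep _ _ _).1 hξ.indep) hdisj
  refine indep_of_indep_of_le_right hindep (Measurable.comap_le ?_)
  refine @measurable_pi_lambda _ _ _ (_) _ _ fun i ↦ (comap_measurable (ξ t k i)).mono ?_ le_rfl
  exact le_biSup (fun p : ℕ × ℕ × ℕ ↦ MeasurableSpace.comap (ξ p.1 p.2.1 p.2.2) inferInstance)
    (i := (t, k, i)) ⟨rfl, rfl⟩

end Measurability

/-! ### One run -/

section OneRun

lemma batch_variance_le {l ρ α σ m N : ℝ} (hl : 0 < l) (hρ : 0 < ρ) (hm : 0 < m) (hN : 0 < N)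
    (h : 440 * l * N * α ^ 2 * σ ^ 2 ≤ ρ ^ 2 * m) :
    220 * l ^ 2 / ρ ^ 2 * α ^ 2 * (σ ^ 2 / m) ≤ l / (2 * N) :=
  calc 220 * l ^ 2 / ρ ^ 2 * α ^ 2 * (σ ^ 2 / m)
      = l / (2 * N) * (440 * l * N * α ^ 2 * σ ^ 2 / (ρ ^ 2 * m)) := by field_simp; ring
    _ ≤ l / (2 * N) := mul_le_of_le_one_right (by positivity) ((div_le_one (by positivity)).2 h)

lemma le_exp_neg_of_exp_mul_le {l : ℝ} (hl : 0 ≤ l) {N : ℕ} (hN : N ≠ 0) {p : ENNReal}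
    (h : ENNReal.ofReal (Real.exp (2 * l)) * p ≤
      ENNReal.ofReal (Real.exp (l / (2 * N))) ^ N * ENNReal.ofReal (Real.exp (2 * l / 5))) :
    p ≤ ENNReal.ofReal (Real.exp (-l)) := by
  have hpow : ENNReal.ofReal (Real.exp (l / (2 * N))) ^ N = ENNReal.ofReal (Real.exp (l / 2)) := by
    rw [← ENNReal.ofReal_pow (Real.exp_pos _).le, ← Real.exp_nat_mul]
    congr 2
    field_simp
  rw [hpow, mul_comm, ← ENNReal.le_div_iff_mul_le (Or.inl (by positivity)) (Or.inl (by simp)),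
    ← ENNReal.ofReal_mul (Real.exp_pos _).le, ← ENNReal.ofReal_div_of_pos (Real.exp_pos _),
    ← Real.exp_add, ← Real.exp_sub] at h
  refine h.trans (ENNReal.ofReal_le_ofReal (Real.exp_le_exp.2 ?_))
  linarith

variable {n : ℕ} {S Ω : Type*} [MeasurableSpace S] [MeasurableSpace Ω]
  {Pr : Measure Ω} [IsProbabilityMeasure Pr] {P : Measure S}
  {f : EuclideanSpace ℝ (Fin n) → ℝ} {g : EuclideanSpace ℝ (Fin n) → S → EuclideanSpace ℝ (Fin n)}
  {ξ : ℕ → ℕ → ℕ → Ω → S} {X : Ω → EuclideanSpace ℝ (Fin n)} {xs : EuclideanSpace ℝ (Fin n)}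
  {L σ a l ρ : ℝ} {m : ℕ → ℕ} {t : ℕ}

lemma setLIntegral_expPotential_zero_le (hl : 0 ≤ l) (hρ : 0 < ρ) {A : Set Ω}
    (hA : MeasurableSet A)
    {U : Ω → EuclideanSpace ℝ (Fin n) × EuclideanSpace ℝ (Fin n)}
    (hU : ∀ ω ∈ A, ‖(U ω).2 - xs‖ ^ 2 ≤ ρ ^ 2 / 5) :
    ∫⁻ ω in A, expPotential a L l ρ f xs 0 (U ω) ∂Pr ≤ ENNReal.ofReal (Real.exp (2 * l / 5)) :=
  calc ∫⁻ ω in A, expPotential a L l ρ f xs 0 (U ω) ∂Pr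
      ≤ ∫⁻ _ in A, ENNReal.ofReal (Real.exp (2 * l / 5)) ∂Pr :=
        setLIntegral_mono' hA fun ω hω ↦ expPotential_zero_le hl hρ (hU ω hω)
    _ = ENNReal.ofReal (Real.exp (2 * l / 5)) * Pr A := setLIntegral_const _ _
    _ ≤ ENNReal.ofReal (Real.exp (2 * l / 5)) := mul_le_of_le_one_right' prob_le_one

lemma setLIntegral_expPotential_sstm_succ_le (hL : 0 < L) (hfm : Measurable f)
    (hconv : ∀ x y, f y + inner ℝ (∇ f y) (x - y) ≤ f x)
    (hquad : ∀ x y, f x ≤ f y + inner ℝ (∇ f y) (x - y) + L / 2 * ‖x - y‖ ^ 2)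
    (hxs : ∀ x, f xs ≤ f x) (hg : IsStochasticGradient P σ f g) (hξ : IsIIDSample Pr P ξ)
    (hl : 2 ≤ l) (hρ : 0 < ρ) (ha : 576 * l ^ 2 ≤ a) {k : ℕ} (hm : m k ≠ 0) {c : ℝ}
    (hbatch : 220 * l ^ 2 / ρ ^ 2 * alpha a L (k + 1) ^ 2 * (σ ^ 2 / m k) ≤ c)
    (hX : Measurable[pastSigma ξ t 0] X) {D : Set Ω} (hD : MeasurableSet[pastSigma ξ t k] D)
    (hpot : ∀ ω ∈ D, potential a L f xs k
      (sstm g L a (ρ / (8 * l)) m (fun k i ↦ ξ t k i ω) (X ω) k) ≤ ρ ^ 2) :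
    ∫⁻ ω in D, expPotential a L l ρ f xs (k + 1)
        (sstm g L a (ρ / (8 * l)) m (fun k i ↦ ξ t k i ω) (X ω) (k + 1)) ∂Pr ≤
      ENNReal.ofReal (Real.exp c) * ∫⁻ ω in D, expPotential a L l ρ f xs k
        (sstm g L a (ρ / (8 * l)) m (fun k i ↦ ξ t k i ω) (X ω) k) ∂Pr := by
  have hbatch_meas : Measurable fun ω i ↦ ξ t k i ω :=
    measurable_pi_iff.2 fun i ↦ hξ.measurable t k i
  have hcond := setLIntegral_comp_prod_of_indep (hξ.pastSigma_le t k) hD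
    (measurable_sstm_pastSigma hg.measurable L a (ρ / (8 * l)) m hX k) hbatch_meas
    (hξ.indep_pastSigma t k) ((measurable_expPotential a L l ρ hfm xs (k + 1)).comp
      (measurable_sstmStep hg.measurable L a (ρ / (8 * l)) (m k) k))
  refine hcond.trans_le ?_
  rw [← lintegral_const_mul' _ _ ENNReal.ofReal_ne_top]
  exact setLIntegral_mono' (hξ.pastSigma_le t k _ hD) fun ω hω ↦
    lintegral_expPotential_sstmStep_le hL hconv hquad hxs hg (hξ.measurePreserving t k)
      (hξ.pairwise_indepFun t k) hl hρ ha hm hbatch (hpot ω hω)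

lemma measure_potential_gt_le (hL : 0 < L) (hfm : Measurable f)
    (hconv : ∀ x y, f y + inner ℝ (∇ f y) (x - y) ≤ f x)
    (hquad : ∀ x y, f x ≤ f y + inner ℝ (∇ f y) (x - y) + L / 2 * ‖x - y‖ ^ 2)
    (hxs : ∀ x, f xs ≤ f x) (hg : IsStochasticGradient P σ f g) (hξ : IsIIDSample Pr P ξ)
    (hl : 2 ≤ l) (hρ : 0 < ρ) (ha : 576 * l ^ 2 ≤ a) (hm : ∀ k, m k ≠ 0) {N : ℕ} (hN : N ≠ 0)
    (hbatch : ∀ k, 440 * l * N * alpha a L (k + 1) ^ 2 * σ ^ 2 ≤ ρ ^ 2 * m k)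
    (hX : Measurable[pastSigma ξ t 0] X) :
    Pr {ω | ‖X ω - xs‖ ^ 2 ≤ ρ ^ 2 / 5 ∧ ρ ^ 2 < potential a L f xs N
      (sstm g L a (ρ / (8 * l)) m (fun k i ↦ ξ t k i ω) (X ω) N)} ≤
      ENNReal.ofReal (Real.exp (-l)) := by
  have hl0 : 0 < l := two_pos.trans_le hl
  set U : ℕ → Ω → EuclideanSpace ℝ (Fin n) × EuclideanSpace ℝ (Fin n) := fun k ω ↦
    sstm g L a (ρ / (8 * l)) m (fun k i ↦ ξ t k i ω) (X ω) k
  set W : ℕ → Ω → ENNReal := fun k ω ↦ expPotential a L l ρ f xs k (U k ω)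
  set A : Set Ω := {ω | ‖X ω - xs‖ ^ 2 ≤ ρ ^ 2 / 5}
  set e := ENNReal.ofReal (Real.exp (2 * l))
  set q := ENNReal.ofReal (Real.exp (l / (2 * N)))
  have hW {j k : ℕ} (hj : j ≤ k) : Measurable[pastSigma ξ t k] (W j) :=
    (measurable_expPotential a L l ρ hfm xs j).comp
      ((measurable_sstm_pastSigma hg.measurable L a (ρ / (8 * l)) m hX j).mono
        (pastSigma_mono (Or.inr ⟨rfl, hj⟩)) le_rfl)
  have hWm (k : ℕ) : Measurable (W k) := (hW le_rfl).mono (hξ.pastSigma_le t k) le_rfl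
  have hA : MeasurableSet[pastSigma ξ t 0] A :=
    ((measurable_norm.comp (hX.sub_const xs)).pow_const 2) measurableSet_Iic
  have hstart : ∫⁻ ω in A, W 0 ω ∂Pr ≤ ENNReal.ofReal (Real.exp (2 * l / 5)) :=
    setLIntegral_expPotential_zero_le hl0.le hρ (hξ.pastSigma_le t 0 _ hA) fun _ hω ↦ hω
  have hstep (k : ℕ) : ∫⁻ ω in staysBelow W e k, W (k + 1) ω ∂Pr.restrict A ≤
      q * ∫⁻ ω in staysBelow W e k, W k ω ∂Pr.restrict A := by
    have hD : MeasurableSet[pastSigma ξ t k] (staysBelow W e k) :=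
      measurableSet_staysBelow e fun _ ↦ hW
    rw [Measure.restrict_restrict (hξ.pastSigma_le t k _ hD)]
    refine setLIntegral_expPotential_sstm_succ_le hL hfm hconv hquad hxs hg hξ hl hρ ha (hm k) ?_
      hX (hD.inter (pastSigma_mono (Or.inr ⟨rfl, k.zero_le⟩) _ hA))
      fun ω hω ↦ (expPotential_le_iff hl0 hρ).1 (hω.1 k le_rfl)
    exact batch_variance_le hl0 hρ (by exact_mod_cast (hm k).bot_lt) (by exact_mod_cast hN.bot_lt)
      (hbatch k)
  have hmax := mul_measure_lt_le_of_setLIntegral_le hWm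
    (ENNReal.one_le_ofReal.2 (Real.one_le_exp (by positivity))) hstep N
  rw [Measure.restrict_apply (measurableSet_lt measurable_const (hWm N))] at hmax
  refine (measure_mono fun ω hω ↦ ?_).trans
    (le_exp_neg_of_exp_mul_le hl0.le hN (hmax.trans (by gcongr)))
  exact ⟨not_le.1 fun h ↦ hω.2.not_ge ((expPotential_le_iff hl0 hρ).1 h), hω.1⟩

lemma measure_gap_gt_le {μ : ℝ} (hμ : 0 < μ) (hL : 0 < L) (hc : IsStronglyConvex μ f)
    (hf : IsSmooth L f) (hxs : ∀ x, f xs ≤ f x) (hg : IsStochasticGradient P σ f g)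
    (hξ : IsIIDSample Pr P ξ) (hl : 2 ≤ l) (hρ : 0 < ρ) (ha : 576 * l ^ 2 ≤ a)
    (hm : ∀ k, m k ≠ 0) {N : ℕ} (hN : √5 * √(8 * a * L / μ) ≤ N)
    (hbatch : ∀ k, 440 * l * N * alpha a L (k + 1) ^ 2 * σ ^ 2 ≤ ρ ^ 2 * m k)
    (hX : Measurable[pastSigma ξ t 0] X) :
    Pr {ω | f (X ω) - f xs ≤ μ * ρ ^ 2 / 10 ∧ μ * ρ ^ 2 / 20 <
      f (sstm g L a (ρ / (8 * l)) m (fun k i ↦ ξ t k i ω) (X ω) N).1 - f xs} ≤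
      ENNReal.ofReal (Real.exp (-l)) := by
  have ha0 : 0 < a := (by positivity : 0 < 576 * l ^ 2).trans_le ha
  have hN0 : N ≠ 0 :=
    Nat.cast_ne_zero.1 ((by positivity : 0 < √5 * √(8 * a * L / μ)).trans_le hN).ne'
  refine (measure_mono fun ω hω ↦ ?_).trans
    (measure_potential_gt_le hL hf.1.continuous.measurable (hc.add_inner_le hμ.le) hf.le_quadratic
      hxs hg hξ hl hρ ha hm hN0 hbatch hX)
  refine ⟨?_, not_le.1 fun hpot ↦ hω.2.not_ge (gap_le_of_potential_le hμ hL ha0 hN hxs hpot)⟩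
  calc ‖X ω - xs‖ ^ 2 ≤ 2 * (f (X ω) - f xs) / μ := hc.norm_sub_sq_le hμ hxs (X ω)
    _ ≤ 2 * (μ * ρ ^ 2 / 10) / μ := by gcongr; exact hω.1
    _ = ρ ^ 2 / 5 := by field_simp; norm_num

end OneRun

/-! ### The restarted method -/

section Restart

section Parameters

variable {R β : ℝ} {N₀ τ : ℕ}

lemma le_aMin (hl : 0 ≤ logTerm N₀ τ β) : 576 * logTerm N₀ τ β ^ 2 ≤ aMin N₀ τ β := by
  set l := logTerm N₀ τ β
  have hsqrt : 2 * l ≤ √(4 * l ^ 2 + 2 * l) := Real.le_sqrt_of_sq_le (by linarith)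
  calc 576 * l ^ 2 = 36 * (2 * l + 2 * l) ^ 2 := by ring
    _ ≤ 36 * (2 * l + √(4 * l ^ 2 + 2 * l)) ^ 2 := by gcongr
    _ ≤ aMin N₀ τ β := (le_max_right _ _).trans (le_max_right _ _)

lemma mul_exp_neg_logTerm_le (hβ : 0 < β) (hN₀ : N₀ ≠ 0) :
    τ * Real.exp (-logTerm N₀ τ β) ≤ β := by
  rcases eq_or_ne τ 0 with rfl | hτ
  · simpa using hβ.le
  have hN₀' : (1 : ℝ) ≤ N₀ := by exact_mod_cast Nat.one_le_iff_ne_zero.2 hN₀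
  have : (0 : ℝ) < τ := by exact_mod_cast Nat.pos_of_ne_zero hτ
  rw [logTerm, Real.exp_neg, Real.exp_log (by positivity)]
  calc τ * (4 * N₀ * τ / β)⁻¹ = β / (4 * N₀) := by field_simp
    _ ≤ β := div_le_self hβ.le (by linarith)

/-- The radius `C R_t = √5 R / 2 ^ (t / 2)` that bounds the square root of the potential during
run `t`. -/
noncomputable def restartRadius (R : ℝ) (t : ℕ) : ℝ :=
  √5 * R / √2 ^ t

lemma restartRadius_sq (R : ℝ) (t : ℕ) : restartRadius R t ^ 2 = 5 * R ^ 2 / 2 ^ t := by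
  rw [restartRadius, div_pow, mul_pow, Real.sq_sqrt (by norm_num), ← pow_mul, mul_comm t 2, pow_mul,
    Real.sq_sqrt (by norm_num)]

lemma clipParam_eq (R β : ℝ) (N₀ τ t : ℕ) :
    clipParam R β N₀ τ t = restartRadius R t / (8 * logTerm N₀ τ β) := by
  have hpow : (2 : ℝ) ^ ((t : ℝ) / 2) = √2 ^ t := by
    rw [← one_div_mul_eq_div, Real.rpow_mul zero_le_two, ← Real.sqrt_eq_rpow, Real.rpow_natCast]
  rw [clipParam, restartRadius, hpow, div_div]
  congr 1
  ring

lemma batchSize_ne_zero (L a σ R β : ℝ) (N₀ τ t k : ℕ) : batchSize L a σ R β N₀ τ t k ≠ 0 :=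
  (Nat.ceil_pos.2 (lt_max_of_lt_left one_pos)).ne'

lemma le_restartRadius_sq_mul_batchSize {L a σ : ℝ} (hR : R ≠ 0) (hl : 0 ≤ logTerm N₀ τ β)
    (t k : ℕ) :
    440 * logTerm N₀ τ β * N₀ * alpha a L (k + 1) ^ 2 * σ ^ 2 ≤
      restartRadius R t ^ 2 * batchSize L a σ R β N₀ τ t k := by
  set l := logTerm N₀ τ β
  calc 440 * l * N₀ * alpha a L (k + 1) ^ 2 * σ ^ 2
      ≤ 6000 * l * N₀ * alpha a L (k + 1) ^ 2 * σ ^ 2 := by gcongr; norm_num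
    _ = restartRadius R t ^ 2 *
        (6000 * 2 ^ t * σ ^ 2 * alpha a L (k + 1) ^ 2 * N₀ * l / (√5 ^ 2 * R ^ 2)) := by
      rw [restartRadius_sq, Real.sq_sqrt (by norm_num)]
      field_simp
    _ ≤ restartRadius R t ^ 2 * batchSize L a σ R β N₀ τ t k := by
      gcongr
      exact (le_max_left _ _).trans ((le_max_right _ _).trans (Nat.le_ceil _))

end Parameters

section Radius

variable {n : ℕ} {f : EuclideanSpace ℝ (Fin n) → ℝ} {x₀ xs : EuclideanSpace ℝ (Fin n)} {μ : ℝ}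

lemma radius_sq (hμ : 0 ≤ μ) (hx₀ : f xs ≤ f x₀) :
    radius μ f x₀ xs ^ 2 = 2 * (f x₀ - f xs) / μ :=
  Real.sq_sqrt (div_nonneg (mul_nonneg zero_le_two (sub_nonneg.2 hx₀)) hμ)

lemma mul_radius_sq (hμ : 0 < μ) (hx₀ : f xs ≤ f x₀) :
    μ * radius μ f x₀ xs ^ 2 = 2 * (f x₀ - f xs) := by
  rw [radius_sq hμ.le hx₀, mul_div_cancel₀ _ hμ.ne']

lemma mul_restartRadius_radius_sq (hμ : 0 < μ) (hx₀ : f xs ≤ f x₀) (t : ℕ) :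
    μ * restartRadius (radius μ f x₀ xs) t ^ 2 = 10 * ((2 : ℝ)⁻¹ ^ t * (f x₀ - f xs)) := by
  rw [restartRadius_sq, mul_div_assoc', mul_left_comm, mul_radius_sq hμ hx₀, inv_pow]
  ring

end Radius

section DegenerateStart

variable {n : ℕ} {S : Type*} (g : EuclideanSpace ℝ (Fin n) → S → EuclideanSpace ℝ (Fin n))
  {L a : ℝ}

lemma sstm_clip_zero (ha : 0 < a) (hL : 0 < L) (m : ℕ → ℕ) (s : ℕ → ℕ → S)
    (x₀ : EuclideanSpace ℝ (Fin n)) (k : ℕ) : sstm g L a 0 m s x₀ k = (x₀, x₀) := by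
  induction k with
  | zero => rfl
  | succ k ih =>
    rw [sstm_succ, ih, sstmStep, zero_div, clip_zero_right, smul_zero, advance, sub_zero,
      queryPoint_self ha hL]

lemma output_radius_zero (ha : 0 < a) (hL : 0 < L) (σ β : ℝ) (N₀ τ : ℕ) (s : ℕ → ℕ → ℕ → S)
    (x₀ : EuclideanSpace ℝ (Fin n)) : output g L a σ 0 β N₀ τ s x₀ = x₀ := by
  have hB : clipParam 0 β N₀ τ = fun _ ↦ 0 := by
    ext t
    simp [clipParam]
  have hrestart (t : ℕ) :
      restartedSSTM g L a N₀ (fun _ ↦ 0) (batchSize L a σ 0 β N₀ τ) s x₀ t = x₀ := by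
    induction t with
    | zero => rfl
    | succ t ih => rw [restartedSSTM, ih, sstm_clip_zero g ha hL]
  rw [output, hB, hrestart]

end DegenerateStart

lemma ofReal_one_sub_le_of_measure_compl_le {Ω : Type*} [MeasurableSpace Ω] {Pr : Measure Ω}
    [IsProbabilityMeasure Pr] {s : Set Ω} {β : ℝ} (hβ : 0 ≤ β)
    (h : Pr sᶜ ≤ ENNReal.ofReal β) : ENNReal.ofReal (1 - β) ≤ Pr s := by
  rw [ENNReal.ofReal_sub _ hβ, ENNReal.ofReal_one, tsub_le_iff_right, ← measure_univ (μ := Pr)]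
  exact (measure_univ_le_add_compl s).trans (by gcongr)

section HighProbability

variable {n : ℕ} {S Ω : Type*} [MeasurableSpace S] [MeasurableSpace Ω]
  {Pr : Measure Ω} [IsProbabilityMeasure Pr] {P : Measure S}
  {f : EuclideanSpace ℝ (Fin n) → ℝ} {g : EuclideanSpace ℝ (Fin n) → S → EuclideanSpace ℝ (Fin n)}
  {ξ : ℕ → ℕ → ℕ → Ω → S} {xs x₀ : EuclideanSpace ℝ (Fin n)} {μ L σ a β : ℝ} {N₀ τ : ℕ}

lemma measure_restart_failure_le (hμ : 0 < μ) (hL : 0 < L) (hc : IsStronglyConvex μ f)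
    (hf : IsSmooth L f) (hxs : ∀ x, f xs ≤ f x) (hg : IsStochasticGradient P σ f g)
    (hξ : IsIIDSample Pr P ξ) (hx₀ : f xs < f x₀) (hl : 2 ≤ logTerm N₀ τ β)
    (ha : aMin N₀ τ β ≤ a) (hN : √5 * √(8 * a * L / μ) ≤ N₀) (t : ℕ) {X : Ω → _}
    (hX : Measurable[pastSigma ξ t 0] X) :
    Pr {ω | f (X ω) - f xs ≤ (2 : ℝ)⁻¹ ^ t * (f x₀ - f xs) ∧
      (2 : ℝ)⁻¹ ^ (t + 1) * (f x₀ - f xs) <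
        f (sstm g L a (clipParam (radius μ f x₀ xs) β N₀ τ t)
          (batchSize L a σ (radius μ f x₀ xs) β N₀ τ t) (fun k i ↦ ξ t k i ω) (X ω) N₀).1 - f xs} ≤
      ENNReal.ofReal (Real.exp (-logTerm N₀ τ β)) := by
  have hl0 : 0 ≤ logTerm N₀ τ β := zero_le_two.trans hl
  have hR : 0 < radius μ f x₀ xs :=
    Real.sqrt_pos.2 (div_pos (mul_pos two_pos (sub_pos.2 hx₀)) hμ)
  have hρ : 0 < restartRadius (radius μ f x₀ xs) t := by
    unfold restartRadius
    positivity
  have hgap := mul_restartRadius_radius_sq hμ hx₀.le t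
  have hrun := measure_gap_gt_le hμ hL hc hf hxs hg hξ hl hρ ((le_aMin hl0).trans ha)
    (batchSize_ne_zero L a σ (radius μ f x₀ xs) β N₀ τ t) hN
    (le_restartRadius_sq_mul_batchSize hR.ne' hl0 t) hX
  rw [hgap, ← clipParam_eq] at hrun
  convert hrun using 6 <;> ring

theorem restartedSSTM_highProbability (hμ : 0 < μ) (hL : 0 < L) (hc : IsStronglyConvex μ f)
    (hf : IsSmooth L f) (hxs : ∀ x, f xs ≤ f x) (hg : IsStochasticGradient P σ f g)
    (hξ : IsIIDSample Pr P ξ) (x₀ : EuclideanSpace ℝ (Fin n)) (hβ : 0 < β)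
    (hl : 2 ≤ logTerm N₀ τ β) (ha : aMin N₀ τ β ≤ a) (hN : √5 * √(8 * a * L / μ) ≤ N₀) :
    ENNReal.ofReal (1 - β) ≤
      Pr {ω | f (output g L a σ (radius μ f x₀ xs) β N₀ τ (fun t k i ↦ ξ t k i ω) x₀) - f xs ≤
        (2 : ℝ)⁻¹ ^ τ * (f x₀ - f xs)} := by
  set R := radius μ f x₀ xs with hR
  have ha0 : 0 < a := (lt_max_of_lt_left one_pos).trans_le ha
  have hN₀ : N₀ ≠ 0 :=
    Nat.cast_ne_zero.1 ((by positivity : 0 < √5 * √(8 * a * L / μ)).trans_le hN).ne'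
  rcases (hxs x₀).eq_or_lt with hx₀ | hx₀
  · have hR0 : R = 0 := by simp [hR, radius, hx₀]
    simp [hR0, output_radius_zero g ha0 hL, hx₀, hβ.le]
  set X : ℕ → Ω → EuclideanSpace ℝ (Fin n) := fun t ω ↦
    restartedSSTM g L a N₀ (clipParam R β N₀ τ) (batchSize L a σ R β N₀ τ)
      (fun t k i ↦ ξ t k i ω) x₀ t
  set G : ℕ → Set Ω := fun t ↦ {ω | f (X t ω) - f xs ≤ (2 : ℝ)⁻¹ ^ t * (f x₀ - f xs)}
  have hstart : G 0 = Set.univ := Set.eq_univ_of_forall fun ω ↦ by simp [G, X, restartedSSTM]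
  have hrun (t : ℕ) : Pr (G t \ G (t + 1)) ≤ ENNReal.ofReal (Real.exp (-logTerm N₀ τ β)) := by
    refine (measure_mono fun ω hω ↦ ?_).trans
      (measure_restart_failure_le hμ hL hc hf hxs hg hξ hx₀ hl ha hN t
        (measurable_restartedSSTM hg.measurable L a N₀ (clipParam R β N₀ τ)
          (batchSize L a σ R β N₀ τ) x₀ t))
    exact ⟨hω.1, not_le.1 hω.2⟩
  refine ofReal_one_sub_le_of_measure_compl_le hβ.le ?_
  calc Pr (G τ)ᶜ ≤ τ * ENNReal.ofReal (Real.exp (-logTerm N₀ τ β)) :=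
        measure_compl_le_mul hstart hrun τ
    _ = ENNReal.ofReal (τ * Real.exp (-logTerm N₀ τ β)) := by
        rw [ENNReal.ofReal_mul τ.cast_nonneg, ENNReal.ofReal_natCast]
    _ ≤ ENNReal.ofReal β := ENNReal.ofReal_le_ofReal (mul_exp_neg_logTerm_le hβ hN₀)

theorem restartedSSTM_highProbability_of_gap_le (hμ : 0 < μ) (hL : 0 < L)
    (hc : IsStronglyConvex μ f) (hf : IsSmooth L f) (hxs : ∀ x, f xs ≤ f x)
    (hg : IsStochasticGradient P σ f g) (hξ : IsIIDSample Pr P ξ) (hβ : 0 < β)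
    (hl : 2 ≤ logTerm N₀ τ β) (ha : aMin N₀ τ β ≤ a) (hN : √5 * √(8 * a * L / μ) ≤ N₀) {ε : ℝ}
    (hgap : f x₀ - f xs ≤ 2 ^ τ * ε) :
    ENNReal.ofReal (1 - β) ≤
      Pr {ω | f (output g L a σ (radius μ f x₀ xs) β N₀ τ (fun t k i ↦ ξ t k i ω) x₀) - f xs ≤
        ε} := by
  have hε : (2 : ℝ)⁻¹ ^ τ * (f x₀ - f xs) ≤ ε := by
    rwa [inv_pow, inv_mul_le_iff₀ (by positivity)]
  refine (restartedSSTM_highProbability hμ hL hc hf hxs hg hξ x₀ hβ hl ha hN).trans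
    (measure_mono fun ω hω ↦ ?_)
  exact le_trans hω hε

end HighProbability

end Restart

/-! ### Existence of admissible parameters -/

section Parameters

variable {β : ℝ} {N₀ τ : ℕ}

lemma one_le_aMin (N₀ τ : ℕ) (β : ℝ) : 1 ≤ aMin N₀ τ β := le_max_left _ _

lemma aMin_le (hl : 2 ≤ logTerm N₀ τ β) : aMin N₀ τ β ≤ 900 * logTerm N₀ τ β ^ 2 := by
  set l := logTerm N₀ τ β
  have hsqrt : √(4 * l ^ 2 + 2 * l) ≤ 3 * l := Real.sqrt_le_iff.2 ⟨by linarith, by nlinarith⟩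
  refine max_le (by nlinarith) (max_le ?_ ?_)
  · calc 16 * l / √5 ≤ 16 * l := div_le_self (by linarith) (Real.one_le_sqrt.2 (by norm_num))
      _ ≤ 900 * l ^ 2 := by nlinarith
  · calc 36 * (2 * l + √(4 * l ^ 2 + 2 * l)) ^ 2 ≤ 36 * (2 * l + 3 * l) ^ 2 := by gcongr
      _ = 900 * l ^ 2 := by ring

lemma two_le_logTerm (hN₀ : 2 ≤ N₀) (hτ : 1 ≤ τ) (hβ : 0 < β) (hβ1 : β < 1) :
    2 ≤ logTerm N₀ τ β := by
  have hN₀' : (2 : ℝ) ≤ N₀ := by exact_mod_cast hN₀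
  have hτ' : (1 : ℝ) ≤ τ := by exact_mod_cast hτ
  have hexp : Real.exp 2 ≤ 8 := by
    rw [← one_add_one_eq_two, Real.exp_add]
    nlinarith [Real.exp_one_lt_d9, Real.exp_pos 1]
  rw [logTerm, Real.le_log_iff_exp_le (by positivity), le_div_iff₀ hβ]
  calc Real.exp 2 * β ≤ 8 * 1 := by gcongr
    _ = 4 * 2 * 1 := by norm_num
    _ ≤ 4 * N₀ * τ := by gcongr

lemma monotoneOn_logTerm (hβ : 0 < β) (hτ : 1 ≤ τ) :
    MonotoneOn (fun N ↦ logTerm N τ β) (Set.Ici 1) := by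
  intro M hM N _ hMN
  have hM' : (0 : ℝ) < M := by exact_mod_cast hM
  have : (0 : ℝ) < τ := by exact_mod_cast hτ
  simp only [logTerm]
  gcongr

lemma monotoneOn_aMin (hτ : 1 ≤ τ) (hβ : 0 < β) (hβ1 : β < 1) :
    MonotoneOn (fun N ↦ aMin N τ β) (Set.Ici 2) := by
  intro M hM N hN hMN
  have hl : 0 ≤ logTerm M τ β := zero_le_two.trans (two_le_logTerm hM hτ hβ hβ1)
  have hle : logTerm M τ β ≤ logTerm N τ β :=
    monotoneOn_logTerm hβ hτ (one_le_two.trans hM : 1 ≤ M) (one_le_two.trans hN : 1 ≤ N) hMN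
  simp only [aMin]
  gcongr

lemma eventually_mul_logTerm_le (c : ℝ) (hτ : 1 ≤ τ) (hβ : 0 < β) :
    ∀ᶠ N : ℕ in Filter.atTop, c * logTerm N τ β ≤ N := by
  have : (0 : ℝ) < τ := by exact_mod_cast hτ
  have hlittle : (fun x : ℝ ↦ c * (Real.log (4 * τ / β) + Real.log x)) =o[Filter.atTop]
      (id : ℝ → ℝ) :=
    ((Asymptotics.isLittleO_const_id_atTop _).add Real.isLittleO_log_id_atTop).const_mul_left c
  filter_upwards [(hlittle.bound zero_lt_one).natCast_atTop, Filter.eventually_ge_atTop 1]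
    with N hN hN1
  have hN' : (0 : ℝ) < N := by exact_mod_cast hN1
  have hlog : logTerm N τ β = Real.log (4 * τ / β) + Real.log N := by
    rw [logTerm, ← Real.log_mul (by positivity) hN'.ne']
    congr 1
    ring
  rw [← hlog, id, one_mul, Real.norm_of_nonneg hN'.le] at hN
  exact (Real.le_norm_self _).trans hN

lemma mul_sqrt_aMin_le {c κ : ℝ} (hc : 0 ≤ c) (hκ : 0 ≤ κ) (hl : 2 ≤ logTerm N₀ τ β) :
    c * √(8 * aMin N₀ τ β * κ) ≤ 85 * c * √κ * logTerm N₀ τ β := by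
  set l := logTerm N₀ τ β
  calc c * √(8 * aMin N₀ τ β * κ) ≤ c * √(8 * (900 * l ^ 2) * κ) := by gcongr; exact aMin_le hl
    _ ≤ c * √((85 * l) ^ 2 * κ) := by gcongr; nlinarith
    _ = 85 * c * √κ * l := by
      rw [Real.sqrt_mul (sq_nonneg _), Real.sqrt_sq (by linarith)]
      ring

lemma exists_ge_and_le_max_of_eventually_le {F : ℕ → ℝ} {m : ℕ} (hF : MonotoneOn F (Set.Ici m))
    (hev : ∀ᶠ N : ℕ in Filter.atTop, F N ≤ N) :
    ∃ N : ℕ, m ≤ N ∧ F N ≤ N ∧ (N : ℝ) ≤ max (m : ℝ) (F N + 1) := by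
  classical
  have hex : ∃ N : ℕ, m ≤ N ∧ F N ≤ N := ((Filter.eventually_ge_atTop m).and hev).exists
  obtain ⟨hmN, hFN⟩ := Nat.find_spec hex
  refine ⟨Nat.find hex, hmN, hFN, le_max_iff.2 ?_⟩
  rcases hmN.eq_or_lt with heq | hlt
  · exact Or.inl (by exact_mod_cast heq.ge)
  · obtain ⟨M, hM⟩ : ∃ M, Nat.find hex = M + 1 := Nat.exists_eq_succ_of_ne_zero (by omega)
    have hMF : (M : ℝ) < F M := by
      by_contra! h
      exact Nat.find_min hex (m := M) (by omega) ⟨by omega, h⟩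
    have hFM : F M ≤ F (Nat.find hex) := hF (Set.mem_Ici.2 (by omega)) hmN (by omega)
    right
    rw [hM] at hFM ⊢
    push_cast
    linarith

theorem exists_iterations {μ L : ℝ} (hμ : 0 < μ) (hμL : μ ≤ L) (hβ : 0 < β) (hβ1 : β < 1)
    (hτ : 1 ≤ τ) :
    ∃ N₀ : ℕ, 1 ≤ N₀ ∧ 2 ≤ logTerm N₀ τ β ∧ √5 * √(8 * aMin N₀ τ β * L / μ) ≤ N₀ ∧
      N₀ ≤ 2 * √5 * √(8 * aMin N₀ τ β * L / μ) := by
  have hκ : 1 ≤ L / μ := (one_le_div hμ).2 hμL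
  simp only [mul_div_assoc _ L μ]
  have hmono : MonotoneOn (fun N ↦ √5 * √(8 * aMin N τ β * (L / μ))) (Set.Ici 2) := by
    intro M hM N hN hMN
    have := monotoneOn_aMin hτ hβ hβ1 hM hN hMN
    dsimp only at this ⊢
    gcongr
  have hev : ∀ᶠ N : ℕ in Filter.atTop, √5 * √(8 * aMin N τ β * (L / μ)) ≤ N := by
    filter_upwards [eventually_mul_logTerm_le (85 * √5 * √(L / μ)) hτ hβ,
      Filter.eventually_ge_atTop 2] with N hN hN2
    exact (mul_sqrt_aMin_le (Real.sqrt_nonneg 5) (by linarith)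
      (two_le_logTerm hN2 hτ hβ hβ1)).trans hN
  obtain ⟨N, hN2, hle, hmax⟩ := exists_ge_and_le_max_of_eventually_le hmono hev
  refine ⟨N, by omega, two_le_logTerm hN2 hτ hβ hβ1, hle, hmax.trans ?_⟩
  have h5 : 1 ≤ √5 := Real.one_le_sqrt.2 (by norm_num)
  have ha : 1 ≤ √(8 * aMin N τ β * (L / μ)) :=
    Real.one_le_sqrt.2 (by nlinarith [one_le_aMin N τ β])
  rw [Nat.cast_ofNat]
  exact max_le (by nlinarith) (by nlinarith)

end Parameters

/-! ### Complexity -/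

section Logarithms

variable {b y : ℝ}

lemma one_lt_of_ceil_logb_ne_zero (hb : 1 < b) (hy : 0 ≤ y) (h : ⌈Real.logb b y⌉₊ ≠ 0) : 1 < y := by
  have hlog : 0 < Real.logb b y := Nat.ceil_pos.1 (Nat.pos_of_ne_zero h)
  have hy0 : 0 < y := hy.lt_of_ne' fun h0 ↦ by simp [h0] at hlog
  exact (Real.logb_pos_iff hb hy0).1 hlog

lemma le_pow_ceil_logb (hb : 1 < b) (hy : 0 < y) : y ≤ b ^ ⌈Real.logb b y⌉₊ := by
  rw [← Real.rpow_natCast, ← Real.logb_le_iff_le_rpow hb hy]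
  exact Nat.le_ceil _

lemma pow_ceil_logb_lt_mul (hb : 1 < b) (hy : 1 ≤ y) : b ^ ⌈Real.logb b y⌉₊ < b * y := by
  have hy0 : 0 < y := one_pos.trans_le hy
  have hceil := Nat.ceil_lt_add_one (Real.logb_nonneg hb hy)
  rw [← Real.rpow_natCast, ← Real.lt_logb_iff_rpow_lt hb (by positivity),
    Real.logb_mul (by positivity) hy0.ne', Real.logb_self_eq_one hb]
  linarith

lemma natCast_le_mul_log_of_two_pow_le {τ : ℕ} (h : 2 ^ τ ≤ y) : τ ≤ 3 / 2 * Real.log y := by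
  have hlog : τ * Real.log 2 ≤ Real.log y := by
    rw [← Real.log_pow]
    exact Real.log_le_log (by positivity) h
  nlinarith [Real.log_two_gt_d9, (τ.cast_nonneg : (0 : ℝ) ≤ τ)]

lemma le_two_mul_of_le_add_log {c : ℝ} (hy : 0 < y) (h : y ≤ c + Real.log y) : y ≤ 2 * c := by
  have hhalf : Real.log y - Real.log 2 ≤ y / 2 - 1 := by
    rw [← Real.log_div hy.ne' two_ne_zero]
    exact Real.log_le_sub_one_of_pos (by positivity)
  linarith [Real.log_two_lt_d9]

end Logarithms

section Complexity

variable {μ L σ β ε R a C₁ q Z : ℝ} {N₀ τ : ℕ}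

lemma ne_zero_of_two_le_logTerm (hl : 2 ≤ logTerm N₀ τ β) : N₀ ≠ 0 ∧ τ ≠ 0 := by
  constructor <;> rintro rfl <;> norm_num [logTerm] at hl

lemma mul_restarts_le (hμ : 0 ≤ μ) (hL : 0 ≤ L) (hC₁ : 0 ≤ C₁) (hl : 2 ≤ logTerm N₀ τ β)
    (hN : N₀ ≤ C₁ * √(8 * aMin N₀ τ β * L / μ)) (hτ : 2 ^ τ ≤ Z) :
    (N₀ * τ : ℝ) ≤ 255 / 2 * C₁ * logTerm N₀ τ β * (√(L / μ) * Real.log Z) := by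
  rw [mul_div_assoc _ L μ] at hN
  have : 0 ≤ logTerm N₀ τ β := zero_le_two.trans hl
  calc (N₀ * τ : ℝ) ≤ (85 * C₁ * √(L / μ) * logTerm N₀ τ β) * (3 / 2 * Real.log Z) := by
        gcongr
        · exact hN.trans (mul_sqrt_aMin_le hC₁ (by positivity) hl)
        · exact natCast_le_mul_log_of_two_pow_le hτ
    _ = 255 / 2 * C₁ * logTerm N₀ τ β * (√(L / μ) * Real.log Z) := by ring

/-- The factor by which `logTerm` may exceed the logarithm in the complexity bounds, when `C₁`
bounds the number of iterations and that logarithm is at least `log q`. -/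
noncomputable def logFactor (C₁ q : ℝ) : ℝ :=
  2 * (Real.log (510 * C₁) / Real.log q + 1)

lemma logFactor_pos (hC₁ : 1 ≤ C₁) (hq : 1 < q) : 0 < logFactor C₁ q := by
  have hlogC : 0 ≤ Real.log (510 * C₁) := Real.log_nonneg (by linarith)
  have hlogq : 0 < Real.log q := Real.log_pos hq
  unfold logFactor
  positivity

lemma mul_div_le_mul_logTerm (hμ : 0 < μ) (hμL : μ ≤ L) (hβ : 0 < β) (hC₁ : 0 ≤ C₁)
    (hl : 2 ≤ logTerm N₀ τ β) (hN : N₀ ≤ C₁ * √(8 * aMin N₀ τ β * L / μ)) (hτ : 2 ^ τ ≤ Z) :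
    4 * N₀ * τ / β ≤ 510 * C₁ * (L / (μ * β) * Real.log Z) * logTerm N₀ τ β := by
  have hκ : 1 ≤ L / μ := (one_le_div hμ).2 hμL
  have hsqrt : √(L / μ) ≤ L / μ := Real.sqrt_le_iff.2 ⟨by linarith, by nlinarith⟩
  have hlogZ : 0 ≤ Real.log Z := Real.log_nonneg ((one_le_pow₀ one_le_two).trans hτ)
  have hNτ := mul_restarts_le hμ.le (hμ.le.trans hμL) hC₁ hl hN hτ
  set l := logTerm N₀ τ β
  have : 0 ≤ l := zero_le_two.trans hl
  calc 4 * N₀ * τ / β = 4 * (N₀ * τ) / β := by rw [mul_assoc]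
    _ ≤ 4 * (255 / 2 * C₁ * l * (√(L / μ) * Real.log Z)) / β := by gcongr 4 * ?_ / β
    _ ≤ 4 * (255 / 2 * C₁ * l * (L / μ * Real.log Z)) / β := by gcongr
    _ = 510 * C₁ * (L / (μ * β) * Real.log Z) * l := by field_simp; ring

lemma logTerm_le (hμ : 0 < μ) (hμL : μ ≤ L) (hβ : 0 < β) (hC₁ : 1 ≤ C₁) (hq : 1 < q)
    (hl : 2 ≤ logTerm N₀ τ β) (hN : N₀ ≤ C₁ * √(8 * aMin N₀ τ β * L / μ)) (hτ : 2 ^ τ ≤ Z)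
    (hT : q ≤ L / (μ * β) * Real.log Z) :
    logTerm N₀ τ β ≤ logFactor C₁ q * Real.log (L / (μ * β) * Real.log Z) := by
  obtain ⟨hN₀, hτ₀⟩ := ne_zero_of_two_le_logTerm hl
  have harg := mul_div_le_mul_logTerm hμ hμL hβ (zero_le_one.trans hC₁) hl hN hτ
  set l := logTerm N₀ τ β
  set T := L / (μ * β) * Real.log Z
  have hT0 : 0 < T := by linarith
  have hl0 : 0 < l := by linarith
  have hself : l ≤ Real.log (510 * C₁) + Real.log T + Real.log l := by
    rw [← Real.log_mul (by positivity) hT0.ne', ← Real.log_mul (by positivity) hl0.ne']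
    exact Real.log_le_log (by positivity) harg
  have hlogq : 0 < Real.log q := Real.log_pos hq
  have hlogC : 0 ≤ Real.log (510 * C₁) := Real.log_nonneg (by linarith)
  have habsorb : Real.log (510 * C₁) ≤ Real.log (510 * C₁) / Real.log q * Real.log T := by
    rw [div_mul_eq_mul_div, le_div_iff₀ hlogq]
    gcongr
  calc l ≤ 2 * (Real.log (510 * C₁) + Real.log T) := le_two_mul_of_le_add_log hl0 hself
    _ ≤ 2 * (Real.log (510 * C₁) / Real.log q * Real.log T + Real.log T) := by gcongr
    _ = logFactor C₁ q * Real.log T := by rw [logFactor]; ring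

lemma batchSize_le (hl : 2 ≤ logTerm N₀ τ β) (t k : ℕ) :
    (batchSize L a σ R β N₀ τ t k : ℝ) ≤
      2 + 2 ^ t * (1200 * σ ^ 2 * alpha a L (k + 1) ^ 2 * N₀ * logTerm N₀ τ β / R ^ 2) := by
  have hsqrt : √5 ^ 2 = 5 := Real.sq_sqrt (by norm_num)
  set l := logTerm N₀ τ β with hldef
  set v := 2 ^ t * σ ^ 2 * alpha a L (k + 1) ^ 2 * N₀ / R ^ 2 with hv
  have hv0 : 0 ≤ v := by positivity
  have hfirst : 6000 * 2 ^ t * σ ^ 2 * alpha a L (k + 1) ^ 2 * N₀ * l / (√5 ^ 2 * R ^ 2) =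
      1200 * v * l := by
    rw [hsqrt, hv]
    ring
  have hsecond : 10368 * 2 ^ t * σ ^ 2 * alpha a L (k + 1) ^ 2 * N₀ / (√5 ^ 2 * R ^ 2) =
      10368 / 5 * v := by
    rw [hsqrt, hv]
    ring
  have hmax : max 1 (max (1200 * v * l) (10368 / 5 * v)) ≤ 1 + 1200 * v * l :=
    max_le (by nlinarith) (max_le (by linarith) (by nlinarith))
  rw [batchSize, ← hldef, hfirst, hsecond]
  calc (⌈max 1 (max (1200 * v * l) (10368 / 5 * v))⌉₊ : ℝ)
      ≤ max 1 (max (1200 * v * l) (10368 / 5 * v)) + 1 :=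
        (Nat.ceil_lt_add_one (zero_le_one.trans (le_max_left _ _))).le
    _ ≤ 1 + 1200 * v * l + 1 := by gcongr
    _ = 2 + 2 ^ t * (1200 * σ ^ 2 * alpha a L (k + 1) ^ 2 * N₀ * l / R ^ 2) := by rw [hv]; ring

lemma alpha_succ_le (ha : 0 < a) (hL : 0 < L) {k : ℕ} (hk : k < N₀) :
    alpha a L (k + 1) ≤ N₀ / (a * L) := by
  have hk' : (k : ℝ) + 1 ≤ N₀ := by exact_mod_cast hk
  rw [alpha_succ]
  calc ((k : ℝ) + 2) / (2 * a * L) ≤ 2 * N₀ / (2 * a * L) := by gcongr; linarith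
    _ = N₀ / (a * L) := by rw [mul_assoc, mul_div_mul_left _ _ two_ne_zero]

lemma oracleCalls_batchSize_le (ha : 0 < a) (hL : 0 < L) (hl : 2 ≤ logTerm N₀ τ β) :
    (oracleCalls N₀ τ (batchSize L a σ R β N₀ τ) : ℝ) ≤
      2 * (N₀ * τ) + 2 ^ τ * (1200 * σ ^ 2 * N₀ ^ 4 * logTerm N₀ τ β / ((a * L) ^ 2 * R ^ 2)) := by
  set l := logTerm N₀ τ β
  set u := 1200 * σ ^ 2 * (N₀ / (a * L)) ^ 2 * N₀ * l / R ^ 2 with hu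
  have : 0 ≤ l := zero_le_two.trans hl
  have hbatch (t k : ℕ) (hk : k < N₀) : (batchSize L a σ R β N₀ τ t k : ℝ) ≤ 2 + 2 ^ t * u := by
    have hα0 := alpha_succ_pos ha hL k
    refine (batchSize_le hl t k).trans ?_
    rw [hu]
    gcongr
    exact alpha_succ_le ha hL hk
  have hgeom : ∑ t ∈ range τ, (2 : ℝ) ^ t ≤ 2 ^ τ := by
    rw [geom_sum_eq (by norm_num)]
    linarith
  rw [oracleCalls]
  push_cast
  calc ∑ t ∈ range τ, ∑ k ∈ range N₀, (batchSize L a σ R β N₀ τ t k : ℝ)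
      ≤ ∑ t ∈ range τ, ∑ k ∈ range N₀, (2 + 2 ^ t * u) :=
        sum_le_sum fun t _ ↦ sum_le_sum fun k hk ↦ hbatch t k (mem_range.1 hk)
    _ = 2 * (N₀ * τ) + (∑ t ∈ range τ, (2 : ℝ) ^ t) * (N₀ * u) := by
        simp only [sum_const, card_range, nsmul_eq_mul, mul_add, sum_add_distrib, sum_mul]
        congr 1
        · ring
        · exact sum_congr rfl fun t _ ↦ by ring
    _ ≤ 2 * (N₀ * τ) + 2 ^ τ * (N₀ * u) := by gcongr
    _ = 2 * (N₀ * τ) + 2 ^ τ * (1200 * σ ^ 2 * N₀ ^ 4 * l / ((a * L) ^ 2 * R ^ 2)) := by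
        rw [hu]
        ring

lemma oracleCalls_batchSize_le_of_two_pow_le (hμ : 0 < μ) (hL : 0 < L) (hε : 0 < ε) (ha : 0 < a)
    (hl : 2 ≤ logTerm N₀ τ β) (hN : N₀ ≤ C₁ * √(8 * a * L / μ)) (hτ : 2 ^ τ ≤ μ * R ^ 2 / ε) :
    (oracleCalls N₀ τ (batchSize L a σ R β N₀ τ) : ℝ) ≤
      2 * (N₀ * τ) + 76800 * C₁ ^ 4 * (σ ^ 2 / (μ * ε)) * logTerm N₀ τ β := by
  have hR : R ≠ 0 := by
    rintro rfl
    simp only [ne_eq, OfNat.ofNat_ne_zero, not_false_eq_true, zero_pow, mul_zero, zero_div] at hτ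
    exact hτ.not_gt (by positivity)
  have hN4 : (N₀ : ℝ) ^ 4 ≤ C₁ ^ 4 * (8 * a * L / μ) ^ 2 := by
    calc (N₀ : ℝ) ^ 4 ≤ (C₁ * √(8 * a * L / μ)) ^ 4 := by gcongr
      _ = C₁ ^ 4 * (√(8 * a * L / μ) ^ 2) ^ 2 := by ring
      _ = C₁ ^ 4 * (8 * a * L / μ) ^ 2 := by rw [Real.sq_sqrt (by positivity)]
  set l := logTerm N₀ τ β
  have : 0 ≤ l := zero_le_two.trans hl
  calc (oracleCalls N₀ τ (batchSize L a σ R β N₀ τ) : ℝ)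
      ≤ 2 * (N₀ * τ) + 2 ^ τ * (1200 * σ ^ 2 * N₀ ^ 4 * l / ((a * L) ^ 2 * R ^ 2)) :=
        oracleCalls_batchSize_le ha hL hl
    _ ≤ 2 * (N₀ * τ) + μ * R ^ 2 / ε *
        (1200 * σ ^ 2 * (C₁ ^ 4 * (8 * a * L / μ) ^ 2) * l / ((a * L) ^ 2 * R ^ 2)) := by gcongr
    _ = 2 * (N₀ * τ) + 76800 * C₁ ^ 4 * (σ ^ 2 / (μ * ε)) * l := by
        field_simp
        ring

/-- The constant `K` of the iteration and oracle complexity bounds; it dominates the constants of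
`mul_restarts_le` (twice) and of `oracleCalls_batchSize_le_of_two_pow_le`. -/
noncomputable def complexityConst (C₁ q : ℝ) : ℝ :=
  (255 * C₁ + 76800 * C₁ ^ 4) * logFactor C₁ q

lemma complexityConst_pos (hC₁ : 1 ≤ C₁) (hq : 1 < q) : 0 < complexityConst C₁ q :=
  mul_pos (by positivity) (logFactor_pos hC₁ hq)

theorem mul_restarts_le_complexityConst_mul (hμ : 0 < μ) (hμL : μ ≤ L) (hβ : 0 < β)
    (hC₁ : 1 ≤ C₁) (hq : 1 < q) (hl : 2 ≤ logTerm N₀ τ β)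
    (hN : N₀ ≤ C₁ * √(8 * aMin N₀ τ β * L / μ)) (hτ : 2 ^ τ ≤ Z)
    (hT : q ≤ L / (μ * β) * Real.log Z) :
    ((N₀ * τ : ℕ) : ℝ) ≤ complexityConst C₁ q *
      (√(L / μ) * Real.log Z * Real.log (L / (μ * β) * Real.log Z)) := by
  have hL : 0 ≤ L := hμ.le.trans hμL
  have hlogZ : 0 ≤ Real.log Z := Real.log_nonneg ((one_le_pow₀ one_le_two).trans hτ)
  have hlT := logTerm_le hμ hμL hβ hC₁ hq hl hN hτ hT
  have : 0 ≤ logFactor C₁ q * Real.log (L / (μ * β) * Real.log Z) := by linarith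
  push_cast
  calc (N₀ * τ : ℝ) ≤ 255 / 2 * C₁ * logTerm N₀ τ β * (√(L / μ) * Real.log Z) :=
        mul_restarts_le hμ.le hL (by linarith) hl hN hτ
    _ ≤ (255 * C₁ + 76800 * C₁ ^ 4) *
        (logFactor C₁ q * Real.log (L / (μ * β) * Real.log Z)) * (√(L / μ) * Real.log Z) := by
        gcongr
        linarith [pow_nonneg (zero_le_one.trans hC₁) 4]
    _ = complexityConst C₁ q *
        (√(L / μ) * Real.log Z * Real.log (L / (μ * β) * Real.log Z)) := by
        rw [complexityConst]
        ring

theorem oracleCalls_le_complexityConst_mul (hμ : 0 < μ) (hμL : μ ≤ L) (hβ : 0 < β) (hε : 0 < ε)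
    (hC₁ : 1 ≤ C₁) (hq : 1 < q) (hl : 2 ≤ logTerm N₀ τ β)
    (hN : N₀ ≤ C₁ * √(8 * aMin N₀ τ β * L / μ)) (hτ : 2 ^ τ ≤ μ * R ^ 2 / ε)
    (hT : q ≤ L / (μ * β) * Real.log (μ * R ^ 2 / ε)) :
    (oracleCalls N₀ τ (batchSize L (aMin N₀ τ β) σ R β N₀ τ) : ℝ) ≤ complexityConst C₁ q *
      (max (√(L / μ) * Real.log (μ * R ^ 2 / ε)) (σ ^ 2 / (μ * ε)) *
        Real.log (L / (μ * β) * Real.log (μ * R ^ 2 / ε))) := by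
  have hL : 0 < L := hμ.trans_le hμL
  have hNτ := mul_restarts_le hμ.le hL.le (by linarith) hl hN hτ
  have hlT := logTerm_le hμ hμL hβ hC₁ hq hl hN hτ hT
  set X := Real.log (μ * R ^ 2 / ε)
  set l := logTerm N₀ τ β
  set M := max (√(L / μ) * X) (σ ^ 2 / (μ * ε))
  have : 0 ≤ M := le_max_of_le_right (by positivity)
  calc (oracleCalls N₀ τ (batchSize L (aMin N₀ τ β) σ R β N₀ τ) : ℝ)
      ≤ 2 * (N₀ * τ) + 76800 * C₁ ^ 4 * (σ ^ 2 / (μ * ε)) * l :=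
        oracleCalls_batchSize_le_of_two_pow_le hμ hL hε
          (one_pos.trans_le (one_le_aMin N₀ τ β)) hl hN hτ
    _ ≤ 2 * (255 / 2 * C₁ * l * (√(L / μ) * X)) + 76800 * C₁ ^ 4 * (σ ^ 2 / (μ * ε)) * l := by
        gcongr
    _ ≤ 2 * (255 / 2 * C₁ * l * M) + 76800 * C₁ ^ 4 * M * l := by
        gcongr
        · exact le_max_left _ _
        · exact le_max_right _ _
    _ = (255 * C₁ + 76800 * C₁ ^ 4) * M * l := by ring
    _ ≤ (255 * C₁ + 76800 * C₁ ^ 4) * M *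
        (logFactor C₁ q * Real.log (L / (μ * β) * X)) := by gcongr
    _ = complexityConst C₁ q * (M * Real.log (L / (μ * β) * X)) := by
        rw [complexityConst]
        ring

end Complexity

end ClippedSSTM

theorem mainTheorem4 :
    -- the high-probability bound after `τ` restarts
    (∀ {n : ℕ} {Ω S : Type*} [MeasurableSpace Ω] [MeasurableSpace S]
      (Pr : Measure Ω) [IsProbabilityMeasure Pr] (P : Measure S) [IsProbabilityMeasure P]
      (f : EuclideanSpace ℝ (Fin n) → ℝ)
      (g : EuclideanSpace ℝ (Fin n) → S → EuclideanSpace ℝ (Fin n))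
      (ξ : ℕ → ℕ → ℕ → Ω → S) (x₀ xs : EuclideanSpace ℝ (Fin n))
      (μ L σ β a : ℝ) (N₀ τ : ℕ),
      0 < μ → 0 < L → 0 ≤ σ →
      IsStronglyConvex μ f → IsSmooth L f → (∀ x, f xs ≤ f x) →
      IsStochasticGradient P σ f g → IsIIDSample Pr P ξ →
      0 < β → β < 1 → 1 ≤ N₀ → 2 ≤ logTerm N₀ τ β →
      aMin N₀ τ β ≤ a → √5 * √(8 * a * L / μ) ≤ N₀ →
      ENNReal.ofReal (1 - β) ≤
        Pr {ω | f (output g L a σ (radius μ f x₀ xs) β N₀ τ (fun t k i => ξ t k i ω) x₀) - f xs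
          ≤ (2 : ℝ)⁻¹ ^ τ * (f x₀ - f xs)}) ∧
    -- the complexity: `K` depends on `C₁` and `q` only
    (∀ C₁ q : ℝ, √5 ≤ C₁ → 1 < q → ∃ K : ℝ, 0 < K ∧
      ∀ {n : ℕ} {Ω S : Type*} [MeasurableSpace Ω] [MeasurableSpace S]
        (Pr : Measure Ω) [IsProbabilityMeasure Pr] (P : Measure S) [IsProbabilityMeasure P]
        (f : EuclideanSpace ℝ (Fin n) → ℝ)
        (g : EuclideanSpace ℝ (Fin n) → S → EuclideanSpace ℝ (Fin n))
        (ξ : ℕ → ℕ → ℕ → Ω → S) (x₀ xs : EuclideanSpace ℝ (Fin n))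
        (μ L σ β ε R a : ℝ) (N₀ τ : ℕ),
        0 < μ → 0 < L → 0 ≤ σ →
        IsStronglyConvex μ f → IsSmooth L f → (∀ x, f xs ≤ f x) →
        IsStochasticGradient P σ f g → IsIIDSample Pr P ξ →
        0 < β → β < 1 → 0 < ε → R = radius μ f x₀ xs →
        τ = ⌈Real.logb 2 (μ * R ^ 2 / (2 * ε))⌉₊ →
        1 ≤ N₀ → 2 ≤ logTerm N₀ τ β →
        a = aMin N₀ τ β →
        √5 * √(8 * a * L / μ) ≤ N₀ → N₀ ≤ C₁ * √(8 * a * L / μ) →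
        ENNReal.ofReal (1 - β) ≤
          Pr {ω | f (output g L a σ R β N₀ τ (fun t k i => ξ t k i ω) x₀) - f xs ≤ ε} ∧
        (q ≤ L / (μ * β) * Real.log (μ * R ^ 2 / ε) →
          ((N₀ * τ : ℕ) : ℝ) ≤ K * (√(L / μ) * Real.log (μ * R ^ 2 / ε) *
            Real.log (L / (μ * β) * Real.log (μ * R ^ 2 / ε))) ∧
          (oracleCalls N₀ τ (batchSize L a σ R β N₀ τ) : ℝ) ≤
            K * (max (√(L / μ) * Real.log (μ * R ^ 2 / ε)) (σ ^ 2 / (μ * ε)) *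
              Real.log (L / (μ * β) * Real.log (μ * R ^ 2 / ε))))) ∧
    -- the parameters of the complexity bound can be chosen, for some numerical constant `C₁`
    (∃ C₁ : ℝ, √5 ≤ C₁ ∧ ∀ (μ L β : ℝ) (τ : ℕ),
      0 < μ → μ ≤ L → 0 < β → β < 1 → 1 ≤ τ →
      ∃ N₀ : ℕ, 1 ≤ N₀ ∧ 2 ≤ logTerm N₀ τ β ∧
        √5 * √(8 * aMin N₀ τ β * L / μ) ≤ N₀ ∧
        N₀ ≤ C₁ * √(8 * aMin N₀ τ β * L / μ)) := by
  refine ⟨?_, fun C₁ q hC₁ hq ↦ ?_, 2 * √5, by linarith [Real.sqrt_nonneg 5],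
    fun μ L β τ hμ hμL hβ hβ1 hτ ↦ exists_iterations hμ hμL hβ hβ1 hτ⟩
  · intro n Ω S _ _ Pr _ P _ f g ξ x₀ xs μ L σ β a N₀ τ hμ hL _ hc hf hxs hg hξ hβ _ _ hl ha hN
    exact restartedSSTM_highProbability hμ hL hc hf hxs hg hξ x₀ hβ hl ha hN
  · have hC₁ : 1 ≤ C₁ := (Real.one_le_sqrt.2 (by norm_num)).trans hC₁
    refine ⟨complexityConst C₁ q, complexityConst_pos hC₁ hq, ?_⟩
    rintro n Ω S _ _ Pr _ P _ f g ξ x₀ xs μ L σ β ε _ _ N₀ τ hμ hL _ hc hf hxs hg hξ hβ _ hε rfl hτ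
      _ hl rfl hN hN'
    set R := radius μ f x₀ xs
    have hgap : f x₀ - f xs = μ * R ^ 2 / (2 * ε) * ε := by
      rw [mul_radius_sq hμ (hxs x₀)]
      field_simp
    have hy : 1 < μ * R ^ 2 / (2 * ε) := one_lt_of_ceil_logb_ne_zero one_lt_two (by positivity)
      (hτ ▸ (ne_zero_of_two_le_logTerm hl).2)
    have hle : μ * R ^ 2 / (2 * ε) ≤ 2 ^ τ := hτ ▸ le_pow_ceil_logb one_lt_two (by linarith)
    have hτle : 2 ^ τ ≤ μ * R ^ 2 / ε := calc
      (2 : ℝ) ^ τ ≤ 2 * (μ * R ^ 2 / (2 * ε)) := hτ ▸ (pow_ceil_logb_lt_mul one_lt_two hy.le).le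
      _ = μ * R ^ 2 / ε := by field_simp
    have hμL : μ ≤ L := hc.le_of_isSmooth hf (x := x₀) (y := xs) (by rintro rfl; nlinarith)
    refine ⟨restartedSSTM_highProbability_of_gap_le hμ hL hc hf hxs hg hξ hβ hl le_rfl hN
      (by rw [hgap]; gcongr), fun hT ↦ ⟨?_, ?_⟩⟩
    · exact mul_restarts_le_complexityConst_mul hμ hμL hβ hC₁ hq hl hN' hτle hT
    · exact oracleCalls_le_complexityConst_mul hμ hμL hβ hε hC₁ hq hl hN' hτle hT
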